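/- An Orlicz function is a convex function $M:[0,\infty)\to[0,\infty)$ with $M(0)=0$ and $M(t)>0$ for $t>0$. It is called 2-concave (strictly 2-concave) if $u\mapsto M(\sqrt u)$ is concave (strictly concave) on $[0,\infty)$. Its conjugate is $M^*(x)=\sup_{t\ge 0}(xt-M(t))\in[0,\infty]$ for $x\ge 0$, and $M^{*-1}(y)=\max\{s\ge 0: M^*(s)\le y\}$ for $y\ge 0$. For Orlicz functions $M_1,\dots,M_n$, the Musielak–Orlicz space $\ell^n_{\Sigma M_i}$ is $\mathbb R^n$ with the norm $$\|x\|_{\Sigma M_i}=\inf\Big\{\rho>0:\ \sum_{i=1}^n M_i\Big(\frac{|x_i|}{\rho}\Big)\le 1\Big\}.$$ $L_1^N$ is $\mathbb R^N$ with the norm $\frac1N\sum_{k=1}^N|z_k|$, and $d(X,Y)=\inf\{\|T\|\,\|T^{-1}\|: T:X\to Y \text{ an isomorphism}\}$ is the Banach–Mazur distance. There is an absolute constant $C>1$ such that for every $n\in\mathbb N$ and all Orlicz functions $M_1,\dots,M_n$ the following hold. (a) If $M_1,\dots,M_n$ are 2-concave (in particular, if they are strictly convex, twice differentiable and strictly 2-concave),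 then there is a subspace $Y_n$ of $L_1^{2^n n!}$ with $\dim Y_n=n$ and $d(\ell^n_{\Sigma M_i},Y_n)\le C$, and there is a linear map $T:\ell^n_{\Sigma M_i}\to L_1[0,1]$ with $\|x\|_{\Sigma M_i}\le\|Tx\|_{L_1}\le C\|x\|_{\Sigma M_i}$ for all $x\in\mathbb R^n$. Thus 2-concave Musielak–Orlicz spaces embed uniformly into $L_1$. (b) Suppose that each $M_i$ is strictly convex, strictly 2-concave and twice differentiable on $(0,\infty)$ with $M_i''>0$ there, and that $M_i(t)/t\to 0$ as $t\to 0^+$. Put $H_i=(M_i^{*-1})^2$, $$f_i(t)=-\frac12\int_t^1\frac{H_i''(s)}{\sqrt{H_i(s)-sH_i'(s)}}\,ds+\sqrt{H_i(1)}-\sqrt{H_i(1)-H_i'(1)},\qquad a_{i,j}=n\int_{(j-1)/n}^{j/n}f_i(t)\,dt\quad(1\le i,j\le n).$$ Then the linear map $$\Psi_n:\ell^n_{\Sigma M_i}\to L_1^{2^n n!},\qquad \Psi_n(x)=\Big(\sum_{i=1}^n x_i\varepsilon_i a_{i,\pi(i)}\Big)_{\varepsilon\in\{-1,1\}^n,\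 \pi\in\mathfrak S_n}$$ satisfies $C^{-1}\|x\|_{\Sigma M_i}\le\|\Psi_n(x)\|_{L_1^{2^n n!}}\le C\|x\|_{\Sigma M_i}$ for all $x\in\mathbb R^n$, and one may take $Y_n=\Psi_n(\mathbb R^n)$: it has dimension $n$ and $d(\ell^n_{\Sigma M_i},Y_n)\le C$. -/

import Mathlib

open MeasureTheory Set Filter Topology
open scoped ENNReal

noncomputable section

/-- An Orlicz function: a convex function `M : [0, ∞) → [0, ∞)` with `M 0 = 0` and `M t > 0`
for `t > 0`.  It is represented by a function on `ℝ` of which only the values on `[0, ∞)` are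
ever used. -/
structure OrliczFunction where
  toFun : ℝ → ℝ
  convexOn' : ConvexOn ℝ (Ici 0) toFun
  map_zero' : toFun 0 = 0
  pos' : ∀ t : ℝ, 0 < t → 0 < toFun t

namespace OrliczFunction

instance : CoeFun OrliczFunction (fun _ => ℝ → ℝ) := ⟨OrliczFunction.toFun⟩

/-- `M` is 2-concave: `u ↦ M (√u)` is concave on `[0, ∞)`. -/
def IsTwoConcave (M : OrliczFunction) : Prop :=
  ConcaveOn ℝ (Ici 0) (fun u : ℝ => M (Real.sqrt u))

/-- `M` is strictly 2-concave: `u ↦ M (√u)` is strictly concave on `[0, ∞)`. -/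
def IsStrictlyTwoConcave (M : OrliczFunction) : Prop :=
  StrictConcaveOn ℝ (Ici 0) (fun u : ℝ => M (Real.sqrt u))

/-- `M` is twice differentiable on `(0, ∞)`. -/
def IsTwiceDifferentiable (M : OrliczFunction) : Prop :=
  ∀ t : ℝ, 0 < t → DifferentiableAt ℝ M t ∧ DifferentiableAt ℝ (deriv M) t

/-- The conjugate function `M^* (x) = sup_{t ≥ 0} (x t - M t)`, which may take the value `∞`. -/
def conj (M : OrliczFunction) (x : ℝ) : EReal :=
  ⨆ t : {t : ℝ // 0 ≤ t}, ((x * t - M t : ℝ) : EReal)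

/-- The inverse `M^{*-1}` of the conjugate function, `M^{*-1} (y) = max {s ≥ 0 : M^* (s) ≤ y}`.
This is the usual inverse wherever `M^*` is finite and strictly increasing; for `y` above all
finite values of `M^*` it is the largest point at which `M^*` is finite. -/
def conjInv (M : OrliczFunction) (y : ℝ) : ℝ :=
  sSup {s : ℝ | 0 ≤ s ∧ M.conj s ≤ (y : EReal)}

/-- The function `H = (M^{*-1})²`. -/
def conjInvSq (M : OrliczFunction) (t : ℝ) : ℝ := (M.conjInv t) ^ 2

/-- The density
`f (t) = -(1/2) ∫_t^1 H''(s) / √(H (s) - s H'(s)) ds + √(H (1)) - √(H (1) - H'(1))`. -/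
def density (M : OrliczFunction) (t : ℝ) : ℝ :=
  -(1 / 2) * (∫ s in t..1, deriv (deriv M.conjInvSq) s /
      Real.sqrt (M.conjInvSq s - s * deriv M.conjInvSq s))
    + Real.sqrt (M.conjInvSq 1) - Real.sqrt (M.conjInvSq 1 - deriv M.conjInvSq 1)

theorem nonneg (M : OrliczFunction) {t : ℝ} (ht : 0 ≤ t) : 0 ≤ M t := by
  rcases ht.eq_or_lt with h | h
  · rw [← h, M.map_zero']
  · exact (M.pos' t h).le

theorem map_mul_le (M : OrliczFunction) {r t : ℝ} (hr : 0 ≤ r) (hr1 : r ≤ 1) (ht : 0 ≤ t) :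
    M (r * t) ≤ r * M t := by
  have h := M.convexOn'.2 (mem_Ici.2 ht) (mem_Ici.2 (le_refl (0 : ℝ))) hr (sub_nonneg.2 hr1)
    (by ring)
  simpa [M.map_zero'] using h

theorem mono (M : OrliczFunction) {s t : ℝ} (hs : 0 ≤ s) (hst : s ≤ t) : M s ≤ M t := by
  rcases (hs.trans hst).eq_or_lt with h | h
  · have : s = t := le_antisymm hst (h ▸ hs)
    rw [this]
  · have h1 : M (s / t * t) ≤ s / t * M t :=
      M.map_mul_le (div_nonneg hs h.le) ((div_le_one h).2 hst) h.le
    rw [div_mul_cancel₀ _ h.ne'] at h1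
    exact h1.trans (mul_le_of_le_one_left (M.nonneg h.le) ((div_le_one h).2 hst))

end OrliczFunction

/-- The vector space `ℝⁿ` underlying the Musielak–Orlicz space `ℓ^n_{ΣM_i}`. -/
def MusielakOrliczSpace {n : ℕ} (_M : Fin n → OrliczFunction) : Type := Fin n → ℝ

namespace MusielakOrliczSpace

variable {n : ℕ} (M : Fin n → OrliczFunction)

instance : AddCommGroup (MusielakOrliczSpace M) := inferInstanceAs (AddCommGroup (Fin n → ℝ))
instance : Module ℝ (MusielakOrliczSpace M) := inferInstanceAs (Module ℝ (Fin n → ℝ))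

/-- The Musielak–Orlicz norm `inf {ρ > 0 : ∑ M_i (|x_i| / ρ) ≤ 1}`. -/
def luxNorm (x : Fin n → ℝ) : ℝ :=
  sInf {ρ : ℝ | 0 < ρ ∧ ∑ i, M i (|x i| / ρ) ≤ 1}

theorem admissible_mono {x : Fin n → ℝ} {ρ σ : ℝ} (hρ : 0 < ρ) (hρσ : ρ ≤ σ)
    (h : ∑ i, M i (|x i| / ρ) ≤ 1) : ∑ i, M i (|x i| / σ) ≤ 1 := by
  refine (Finset.sum_le_sum fun i _ => (M i).mono ?_ ?_).trans h
  · exact div_nonneg (abs_nonneg _) (hρ.le.trans hρσ)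
  · exact div_le_div_of_nonneg_left (abs_nonneg _) hρ hρσ

theorem bddBelow_admissible (x : Fin n → ℝ) :
    BddBelow {ρ : ℝ | 0 < ρ ∧ ∑ i, M i (|x i| / ρ) ≤ 1} := ⟨0, fun _ h => h.1.le⟩

theorem nonempty_admissible (x : Fin n → ℝ) :
    {ρ : ℝ | 0 < ρ ∧ ∑ i, M i (|x i| / ρ) ≤ 1}.Nonempty := by
  set S : ℝ := ∑ i, M i (|x i|) with hS
  have hS0 : 0 ≤ S := Finset.sum_nonneg fun i _ => (M i).nonneg (abs_nonneg _)
  have hp : 0 < S + 1 := by linarith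
  refine ⟨S + 1, hp, ?_⟩
  have h : ∀ i, M i (|x i| / (S + 1)) ≤ (S + 1)⁻¹ * M i (|x i|) := by
    intro i
    have := (M i).map_mul_le (inv_nonneg.2 hp.le) (inv_le_one_of_one_le₀ (by linarith))
      (abs_nonneg (x i))
    rwa [inv_mul_eq_div] at this
  calc ∑ i, M i (|x i| / (S + 1)) ≤ ∑ i, (S + 1)⁻¹ * M i (|x i|) :=
        Finset.sum_le_sum fun i _ => h i
    _ = (S + 1)⁻¹ * S := by rw [← Finset.mul_sum]
    _ ≤ 1 := by
        rw [inv_mul_eq_div, div_le_one hp]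
        linarith

theorem luxNorm_nonneg (x : Fin n → ℝ) : 0 ≤ luxNorm M x :=
  Real.sInf_nonneg fun _ h => h.1.le

theorem admissible_of_lt {x : Fin n → ℝ} {σ : ℝ} (h : luxNorm M x < σ) :
    0 < σ ∧ ∑ i, M i (|x i| / σ) ≤ 1 := by
  obtain ⟨ρ, hρ, hlt⟩ := exists_lt_of_csInf_lt (nonempty_admissible M x) h
  exact ⟨hρ.1.trans hlt, admissible_mono M hρ.1 hlt.le hρ.2⟩

theorem luxNorm_le {x : Fin n → ℝ} {ρ : ℝ} (hρ : 0 < ρ) (h : ∑ i, M i (|x i| / ρ) ≤ 1) :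
    luxNorm M x ≤ ρ :=
  csInf_le (bddBelow_admissible M x) ⟨hρ, h⟩

theorem luxNorm_zero : luxNorm M 0 = 0 := by
  refine le_antisymm (le_of_forall_pos_le_add fun ε hε => ?_) (luxNorm_nonneg M 0)
  rw [zero_add]
  refine luxNorm_le M hε ?_
  simp [(M _).map_zero']

theorem luxNorm_add_le (x y : Fin n → ℝ) : luxNorm M (x + y) ≤ luxNorm M x + luxNorm M y := by
  refine le_of_forall_pos_le_add fun ε hε => ?_
  obtain ⟨hr, hx⟩ := admissible_of_lt M (x := x) (σ := luxNorm M x + ε / 2) (by linarith)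
  obtain ⟨hs, hy⟩ := admissible_of_lt M (x := y) (σ := luxNorm M y + ε / 2) (by linarith)
  set r := luxNorm M x + ε / 2
  set s := luxNorm M y + ε / 2
  have hrs : 0 < r + s := add_pos hr hs
  have key : luxNorm M (x + y) ≤ r + s := by
    refine luxNorm_le M hrs ?_
    have h : ∀ i, M i (|(x + y) i| / (r + s)) ≤
        r / (r + s) * M i (|x i| / r) + s / (r + s) * M i (|y i| / s) := by
      intro i
      have hc := (M i).convexOn'.2 (mem_Ici.2 (div_nonneg (abs_nonneg (x i)) hr.le))
        (mem_Ici.2 (div_nonneg (abs_nonneg (y i)) hs.le)) (div_nonneg hr.le hrs.le)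
        (div_nonneg hs.le hrs.le) (by field_simp)
      refine le_trans ((M i).mono (div_nonneg (abs_nonneg _) hrs.le) ?_) hc
      have e : (r / (r + s)) • (|x i| / r) + (s / (r + s)) • (|y i| / s)
          = (|x i| + |y i|) / (r + s) := by
        simp only [smul_eq_mul]
        field_simp
      rw [e]
      exact div_le_div_of_nonneg_right (abs_add_le _ _) hrs.le
    calc ∑ i, M i (|(x + y) i| / (r + s))
        ≤ ∑ i, (r / (r + s) * M i (|x i| / r) + s / (r + s) * M i (|y i| / s)) :=
          Finset.sum_le_sum fun i _ => h i
      _ = r / (r + s) * ∑ i, M i (|x i| / r) + s / (r + s) * ∑ i, M i (|y i| / s) := by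
          rw [Finset.sum_add_distrib, ← Finset.mul_sum, ← Finset.mul_sum]
      _ ≤ r / (r + s) * 1 + s / (r + s) * 1 :=
          add_le_add (mul_le_mul_of_nonneg_left hx (div_nonneg hr.le hrs.le))
            (mul_le_mul_of_nonneg_left hy (div_nonneg hs.le hrs.le))
      _ = 1 := by field_simp
  have e : r + s = luxNorm M x + luxNorm M y + ε := by
    simp only [r, s]
    ring
  linarith

theorem luxNorm_smul_le (c : ℝ) (x : Fin n → ℝ) : luxNorm M (c • x) ≤ |c| * luxNorm M x := by
  rcases eq_or_ne c 0 with rfl | hc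
  · simp [luxNorm_zero]
  · have hc' : 0 < |c| := abs_pos.2 hc
    rw [mul_comm, ← div_le_iff₀ hc']
    refine le_csInf (nonempty_admissible M x) fun ρ hρ => ?_
    rw [div_le_iff₀ hc']
    refine luxNorm_le M (mul_pos hρ.1 hc') ?_
    have e : ∀ i, |(c • x) i| / (ρ * |c|) = |x i| / ρ := by
      intro i
      rw [Pi.smul_apply, smul_eq_mul, abs_mul, mul_comm ρ, mul_div_mul_left _ _ hc'.ne']
    simpa only [e] using hρ.2

theorem luxNorm_neg (x : Fin n → ℝ) : luxNorm M (-x) = luxNorm M x := by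
  simp [luxNorm]

theorem eq_zero_of_luxNorm (x : Fin n → ℝ) (h : luxNorm M x = 0) : x = 0 := by
  funext i
  by_contra hi
  have hxi : 0 < |x i| := abs_pos.2 hi
  have hm : 0 < M i (|x i|) := (M i).pos' _ hxi
  set ρ : ℝ := min 1 (M i (|x i|) / 2) with hρdef
  have hρ : 0 < ρ := lt_min one_pos (half_pos hm)
  have hρ1 : ρ ≤ 1 := min_le_left _ _
  obtain ⟨-, hle⟩ := admissible_of_lt M (x := x) (σ := ρ) (h ▸ hρ)
  have h1 : M i (|x i| / ρ) ≤ 1 :=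
    (Finset.single_le_sum (f := fun i => M i (|x i| / ρ))
      (fun j _ => (M j).nonneg (div_nonneg (abs_nonneg _) hρ.le)) (Finset.mem_univ i)).trans hle
  have h2 := (M i).map_mul_le hρ.le hρ1 (div_nonneg hxi.le hρ.le)
  rw [mul_div_cancel₀ _ hρ.ne'] at h2
  have h3 : ρ * M i (|x i| / ρ) ≤ ρ := mul_le_of_le_one_right hρ.le h1
  have h4 : ρ ≤ M i (|x i|) / 2 := min_le_right _ _
  linarith

/-- `ℓ^n_{ΣM_i}` is `ℝⁿ` with the norm `luxNorm M`. -/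
instance : NormedAddCommGroup (MusielakOrliczSpace M) :=
  AddGroupNorm.toNormedAddCommGroup
    { toFun := luxNorm M
      map_zero' := luxNorm_zero M
      add_le' := luxNorm_add_le M
      neg' := luxNorm_neg M
      eq_zero_of_map_eq_zero' := eq_zero_of_luxNorm M }

theorem norm_def (x : MusielakOrliczSpace M) :
    ‖x‖ = sInf {ρ : ℝ | 0 < ρ ∧ ∑ i, M i (|x i| / ρ) ≤ 1} := rfl

instance : NormedSpace ℝ (MusielakOrliczSpace M) where
  norm_smul_le c x := luxNorm_smul_le M c x

end MusielakOrliczSpace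

/-- The vector space `ℝ^ι` underlying the space `L_1^N`, where `N` is the number of elements of
the finite set `ι`. -/
def AvgL1 (ι : Type) : Type := ι → ℝ

namespace AvgL1

variable (ι : Type) [Fintype ι]

instance : AddCommGroup (AvgL1 ι) := inferInstanceAs (AddCommGroup (ι → ℝ))
instance : Module ℝ (AvgL1 ι) := inferInstanceAs (Module ℝ (ι → ℝ))

/-- `L_1^N` is `ℝ^N` with the averaged norm `(1/N) ∑_k |z_k|`. -/
instance : NormedAddCommGroup (AvgL1 ι) :=
  AddGroupNorm.toNormedAddCommGroup
    { toFun := fun z : ι → ℝ => (1 / (Fintype.card ι : ℝ)) * ∑ k, |z k|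
      map_zero' := by
        change (1 / (Fintype.card ι : ℝ)) * ∑ _k : ι, |(0 : ℝ)| = 0
        simp
      add_le' := fun z w => by
        rw [← mul_add, ← Finset.sum_add_distrib]
        exact mul_le_mul_of_nonneg_left
          (Finset.sum_le_sum fun k _ => abs_add_le (z k) (w k)) (by positivity)
      neg' := fun z => by
        change (1 / (Fintype.card ι : ℝ)) * ∑ k, |-(z k)| = _
        simp only [abs_neg]
      eq_zero_of_map_eq_zero' := fun z hz => by
        funext k
        have hk : (0 : ℝ) < Fintype.card ι := by
          exact_mod_cast Fintype.card_pos_iff.2 ⟨k⟩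
        have h0 : ∑ k, |z k| = 0 := by
          rcases mul_eq_zero.1 hz with h | h
          · exact absurd h (by positivity)
          · exact h
        have := (Finset.sum_eq_zero_iff_of_nonneg fun k _ => abs_nonneg (z k)).1 h0 k
          (Finset.mem_univ k)
        exact abs_eq_zero.1 this }

theorem norm_def (z : AvgL1 ι) : ‖z‖ = (1 / (Fintype.card ι : ℝ)) * ∑ k, |z k| := rfl

instance : NormedSpace ℝ (AvgL1 ι) where
  norm_smul_le c z := by
    rw [norm_def, norm_def, Real.norm_eq_abs, mul_left_comm]
    refine le_of_eq (congrArg _ ?_)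
    rw [Finset.mul_sum]
    refine Finset.sum_congr rfl fun k _ => ?_
    exact abs_mul c (z k)

end AvgL1

/-- The Banach–Mazur distance `d(X, Y) = inf ‖T‖ ‖T⁻¹‖` over all isomorphisms `T : X → Y`; it is
`∞` if there are none. -/
def banachMazurDist (X Y : Type) [NormedAddCommGroup X] [NormedSpace ℝ X]
    [NormedAddCommGroup Y] [NormedSpace ℝ Y] : ℝ≥0∞ :=
  ⨅ T : X ≃L[ℝ] Y, ENNReal.ofReal (‖(T : X →L[ℝ] Y)‖ * ‖(T.symm : Y →L[ℝ] X)‖)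

/-- The pairs `(ε, π)` of a sign vector `ε ∈ {-1, 1}^n` and a permutation `π` of `n` points. -/
abbrev SignPerm (n : ℕ) : Type := (Fin n → ℤˣ) × Equiv.Perm (Fin n)

theorem card_signPerm (n : ℕ) : Fintype.card (SignPerm n) = 2 ^ n * n.factorial := by
  simp [SignPerm, Fintype.card_perm]

/-- The matrix `a_{i,j} = n ∫_{(j-1)/n}^{j/n} f_i (t) dt` for `j = 1, …, n` (here `j` starts
at `0`). -/
def embeddingMatrix {n : ℕ} (M : Fin n → OrliczFunction) : Matrix (Fin n) (Fin n) ℝ :=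
  fun i j => (n : ℝ) * ∫ t in ((j : ℕ) : ℝ) / n..(((j : ℕ) : ℝ) + 1) / n, (M i).density t

/-- The map `x ↦ (∑_i x_i ε_i a_{i,π(i)})_{ε,π}` from `ℓ^n_{ΣM_i}` to `L_1^{2^n n!}`. -/
def embedding {n : ℕ} (M : Fin n → OrliczFunction) :
    MusielakOrliczSpace M →ₗ[ℝ] AvgL1 (SignPerm n) where
  toFun x := fun p : SignPerm n =>
    ∑ i, x i * (((p.1 i : ℤˣ) : ℤ) : ℝ) * embeddingMatrix M i (p.2 i)
  map_add' x y := by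
    funext p
    change ∑ i, (x i + y i) * _ * _ = ∑ i, _ + ∑ i, _
    rw [← Finset.sum_add_distrib]
    exact Finset.sum_congr rfl fun i _ => by ring
  map_smul' c x := by
    funext p
    change ∑ i, (c * x i) * _ * _ = c * ∑ i, _
    rw [Finset.mul_sum]
    exact Finset.sum_congr rfl fun i _ => by ring

end

/-! The matrix of the embedding has rows `α i` chosen so that the average over signs and
permutations reproduces each `M i`. Khinchine's inequality replaces the mean over signs of `|∑ xᵢ εᵢ
a_{i,π(i)}|` by the ℓ₂ norm of the numbers `xᵢ a_{i,π(i)}`. With `b i j = |x i| * a i j`, the mean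
of this norm over `π` is governed by `modular b`, the sum over `i` of the row averages of `min (b,
b²)`: it is at most `modular b + 1/2` and at least `modular b / √(1 + 2 * modular b)`. So the norm
of the image is comparable to the Luxemburg norm of the functions `N i = rowModular n (α i)`,
provided `N i` is comparable to `M i` up to dilation and an error `1/n`; these errors add up to at
most 1 over the `n` rows.

Comparability is read off the conjugate side. For a decreasing row, `N` is described by sums split
at an index `k`: linear in the large terms, quadratic in the small ones. This gives the condition
`Represents`: at `y = k/n`, `H = (M^{*-1})²` is, up to a factor 2, the square of (the first `k`
terms summed, over `n`) plus `y` times (the squares of the others summed, over `n`). Young's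
inequality then turns it into `N (t/4) ≤ M t + 1/n` where `M ≤ 1`, and `M (t/4) ≤ N t + 1/n` where
`N ≤ 1`.

It remains to find such rows. 2-concavity of `M` makes `H` concave. The continuous form of the
condition is `H = F² + t ∫_t^1 f²` with `F' = f`; differentiated, it becomes `(F - t f)² = H - t
H'`, a linear equation for `F` once the root is taken. Concavity of `H` makes the right side
increasing, hence `f` decreasing. In general the equation is solved in discrete form at the points
`k/n`, with exact equality (`exists_represents`). For regular `M` the continuous solution is the
given density after an integration by parts, and replacing it by its interval means costs the factor
2 (`IsRegular.represents`). -/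

noncomputable section

/-! ### Khinchine's inequality for Rademacher sums -/

section RandomSigns

open scoped BigOperators

theorem expect_signs_succ {n : ℕ} (g : (Fin (n + 1) → ℤˣ) → ℝ) :
    𝔼 ε, g ε = 𝔼 ε : Fin n → ℤˣ, (g (Fin.cons 1 ε) + g (Fin.cons (-1) ε)) / 2 := by
  rw [← Fintype.expect_equiv (Fin.consEquiv fun _ => ℤˣ) (fun p => g (Fin.cons p.1 p.2)) g
    (fun _ => rfl), ← Finset.univ_product_univ, Finset.expect_product, Finset.expect_comm]
  refine Finset.expect_congr rfl fun ε _ => ?_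
  rw [Finset.expect_eq_sum_div_card]
  simp [UnitsInt.univ]

/-- The random sum `∑ εᵢ cᵢ`. -/
def signSum {n : ℕ} (c : Fin n → ℝ) (ε : Fin n → ℤˣ) : ℝ := ∑ i, c i * (((ε i : ℤˣ) : ℤ) : ℝ)

theorem signSum_cons {n : ℕ} (c : Fin (n + 1) → ℝ) (s : ℤˣ) (ε : Fin n → ℤˣ) :
    signSum c (Fin.cons s ε) = c 0 * ((s : ℤ) : ℝ) + signSum (fun i => c i.succ) ε := by
  simp [signSum, Fin.sum_univ_succ]

theorem expect_signSum_sq {n : ℕ} (c : Fin n → ℝ) : 𝔼 ε, signSum c ε ^ 2 = ∑ i, c i ^ 2 := by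
  induction n with
  | zero => simp [signSum]
  | succ n ih =>
    rw [expect_signs_succ, Fin.sum_univ_succ, ← ih fun i => c i.succ,
      ← Fintype.expect_const (ι := Fin n → ℤˣ) (c 0 ^ 2), ← Finset.expect_add_distrib]
    refine Finset.expect_congr rfl fun ε _ => ?_
    rw [signSum_cons, signSum_cons]
    push_cast
    ring

theorem expect_signSum_pow_four_le {n : ℕ} (c : Fin n → ℝ) :
    𝔼 ε, signSum c ε ^ 4 ≤ 3 * (∑ i, c i ^ 2) ^ 2 := by
  induction n with
  | zero => simp [signSum]
  | succ n ih =>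
    have h : 𝔼 ε, signSum c ε ^ 4 = c 0 ^ 4 + 6 * c 0 ^ 2 * ∑ i : Fin n, c i.succ ^ 2
        + 𝔼 ε, signSum (fun i => c i.succ) ε ^ 4 := by
      rw [expect_signs_succ, ← expect_signSum_sq fun i => c i.succ, Finset.mul_expect,
        ← Fintype.expect_const (ι := Fin n → ℤˣ) (c 0 ^ 4), ← Finset.expect_add_distrib,
        ← Finset.expect_add_distrib]
      refine Finset.expect_congr rfl fun ε _ => ?_
      rw [signSum_cons, signSum_cons]
      push_cast
      ring
    rw [h, Fin.sum_univ_succ]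
    have := ih fun i => c i.succ
    nlinarith [sq_nonneg (c 0 ^ 2)]

theorem expect_abs_signSum_le {n : ℕ} (c : Fin n → ℝ) :
    𝔼 ε, |signSum c ε| ≤ √(∑ i, c i ^ 2) := by
  set s := √(∑ i, c i ^ 2) with hs
  have hs2 : s ^ 2 = ∑ i, c i ^ 2 := Real.sq_sqrt (Finset.sum_nonneg fun i _ => sq_nonneg _)
  have hs0 : 0 ≤ s := Real.sqrt_nonneg _
  rcases hs0.eq_or_lt with h | h
  · have h0 : ∀ i, c i = 0 := fun i => by
      have := (Finset.sum_eq_zero_iff_of_nonneg fun i _ => sq_nonneg (c i)).1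
        (by rw [← hs2, ← h]; ring) i (Finset.mem_univ i)
      exact pow_eq_zero_iff two_ne_zero |>.1 this
    simp [signSum, h0, ← h]
  -- AM–GM linearizes the square root, which avoids Cauchy–Schwarz for the mean.
  · have h1 : ∀ ε, |signSum c ε| ≤ signSum c ε ^ 2 / (2 * s) + s / 2 := fun ε => by
      rw [div_add_div _ _ (by positivity) two_ne_zero, le_div_iff₀ (by positivity)]
      nlinarith [sq_nonneg (|signSum c ε| - s), sq_abs (signSum c ε)]
    calc 𝔼 ε, |signSum c ε| ≤ 𝔼 ε, (signSum c ε ^ 2 / (2 * s) + s / 2) :=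
          Finset.expect_le_expect fun ε _ => h1 ε
      _ = s := by
          rw [Finset.expect_add_distrib, ← Finset.expect_div, expect_signSum_sq, ← hs2,
            Fintype.expect_const]
          field_simp
          norm_num

/-- Khinchine's inequality in `L₁`. -/
theorem sqrt_le_expect_abs_signSum {n : ℕ} (c : Fin n → ℝ) :
    √(∑ i, c i ^ 2) / √3 ≤ 𝔼 ε, |signSum c ε| := by
  set s := √(∑ i, c i ^ 2) with hs
  have hs2 : s ^ 2 = ∑ i, c i ^ 2 := Real.sq_sqrt (Finset.sum_nonneg fun i _ => sq_nonneg _)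
  have hs0 : 0 ≤ s := Real.sqrt_nonneg _
  rcases hs0.eq_or_lt with h | h
  · rw [← h, zero_div]
    exact Finset.expect_nonneg fun ε _ => abs_nonneg _
  have h3 : 0 < √3 := by positivity
  have h33 : √3 ^ 2 = 3 := Real.sq_sqrt (by norm_num)
  -- The even quartic below minorizes `|x|` and touches it at `l`; its mean is controlled by the
  -- second and fourth moments, and `l = √3 s` maximizes the resulting bound.
  set l := √3 * s with hl
  have hl0 : 0 < l := by positivity
  have hl2 : l ^ 2 = 3 * s ^ 2 := by rw [hl, mul_pow, h33]
  have h1 : ∀ ε, 3 / (2 * l) * signSum c ε ^ 2 - 1 / (2 * l ^ 3) * signSum c ε ^ 4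
      ≤ |signSum c ε| := fun ε => by
    have e2 : signSum c ε ^ 2 = |signSum c ε| ^ 2 := (sq_abs _).symm
    have e4 : signSum c ε ^ 4 = |signSum c ε| ^ 4 := by
      rw [show 4 = 2 * 2 from rfl, pow_mul, pow_mul, sq_abs]
    rw [e2, e4]
    set x := |signSum c ε| with hx
    have hx0 : 0 ≤ x := abs_nonneg _
    have e : x - (3 / (2 * l) * x ^ 2 - 1 / (2 * l ^ 3) * x ^ 4)
        = x * (x - l) ^ 2 * (x + 2 * l) / (2 * l ^ 3) := by
      field_simp
      ring
    have : 0 ≤ x * (x - l) ^ 2 * (x + 2 * l) / (2 * l ^ 3) := by positivity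
    linarith
  have h4 := expect_signSum_pow_four_le c
  rw [← hs2] at h4
  calc s / √3 ≤ 3 / (2 * l) * s ^ 2 - 1 / (2 * l ^ 3) * (3 * (s ^ 2) ^ 2) := by
        have : 3 / (2 * l) * s ^ 2 - 1 / (2 * l ^ 3) * (3 * (s ^ 2) ^ 2)
            = (3 * l ^ 2 * s ^ 2 - 3 * s ^ 4) / (2 * l ^ 3) := by field_simp
        rw [this, show (2 : ℝ) * l ^ 3 = 2 * l * l ^ 2 by ring, hl2, hl]
        refine le_of_eq ?_
        field_simp
        ring
    _ ≤ 3 / (2 * l) * s ^ 2 - 1 / (2 * l ^ 3) * 𝔼 ε, signSum c ε ^ 4 := by gcongr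
    _ = 𝔼 ε, (3 / (2 * l) * signSum c ε ^ 2 - 1 / (2 * l ^ 3) * signSum c ε ^ 4) := by
        rw [Finset.expect_sub_distrib, ← Finset.mul_expect, ← Finset.mul_expect,
          expect_signSum_sq, hs2]
    _ ≤ _ := Finset.expect_le_expect fun ε _ => h1 ε

end RandomSigns

/-! ### Averages over random permutations -/

section RandomPermutations

open scoped BigOperators

theorem expect_perm_apply {n : ℕ} (i : Fin n) (g : Fin n → ℝ) :
    𝔼 π : Equiv.Perm (Fin n), g (π i) = 𝔼 j, g j := by
  have : Nonempty (Fin n) := ⟨i⟩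
  have h : ∀ i', 𝔼 π : Equiv.Perm (Fin n), g (π i') = 𝔼 π : Equiv.Perm (Fin n), g (π i) :=
    fun i' => Fintype.expect_equiv (Equiv.mulRight (Equiv.swap i i')) _ _ fun π => by simp
  rw [← Fintype.expect_const (ι := Fin n) (𝔼 π : Equiv.Perm (Fin n), g (π i)),
    ← Finset.expect_congr rfl fun i' _ => h i', Finset.expect_comm,
    ← Fintype.expect_const (ι := Equiv.Perm (Fin n)) (𝔼 j, g j)]
  exact Finset.expect_congr rfl fun π _ => Fintype.expect_equiv π _ _ fun _ => rfl

/-- The pair `(π i, π k)` is uniform on the `n (n - 1)` off-diagonal pairs, and `n² ≤ 2 n (n - 1)`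
for `n ≥ 2`. It replaces independence of the coordinates of `π`. -/
theorem expect_perm_apply_apply_le {n : ℕ} {i k : Fin n} (hik : i ≠ k) (G : Fin n → Fin n → ℝ)
    (hG : ∀ j l, 0 ≤ G j l) :
    𝔼 π : Equiv.Perm (Fin n), G (π i) (π k) ≤ 2 * 𝔼 j, 𝔼 l, G j l := by
  set T : Fin n → Fin n → ℝ := fun i k => 𝔼 π : Equiv.Perm (Fin n), G (π i) (π k) with hT
  have h : ∀ i' k', i' ≠ k' → T i' k' = T i k := fun i' k' hne => by
    -- Chosen so that `swap i i' * swap k k''` carries `(i, k)` to `(i', k')`.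
    set k'' := Equiv.swap i i' k'
    have hk'' : i ≠ k'' := fun h => hne (by
      have := congrArg (Equiv.swap i i') h
      simpa [k''] using this)
    refine Fintype.expect_equiv (Equiv.mulRight (Equiv.swap i i' * Equiv.swap k k'')) _ _
      fun π => ?_
    simp [Equiv.swap_apply_of_ne_of_ne hik hk'', k'']
  have hn : 2 ≤ n := by
    have := Fin.val_ne_of_ne hik
    omega
  have hn' : (2 : ℝ) ≤ n := by exact_mod_cast hn
  have h1 : ∑ i', ∑ k' ∈ Finset.univ.erase i', T i' k' = n * (n - 1) * T i k := by
    have : ∀ i', ∑ k' ∈ Finset.univ.erase i', T i' k' = (n - 1) * T i k := fun i' => by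
      rw [Finset.sum_congr rfl fun k' hk' => h i' k' (Finset.ne_of_mem_erase hk').symm,
        Finset.sum_const, Finset.card_erase_of_mem (Finset.mem_univ _), Finset.card_univ,
        Fintype.card_fin, nsmul_eq_mul, Nat.cast_sub (by omega), Nat.cast_one]
    simp [this]
    ring
  have h2 : ∑ i', ∑ k' ∈ Finset.univ.erase i', T i' k' ≤ ∑ j, ∑ l, G j l := by
    calc ∑ i', ∑ k' ∈ Finset.univ.erase i', T i' k' ≤ ∑ i', ∑ k', T i' k' :=
          Finset.sum_le_sum fun i' _ => Finset.sum_le_sum_of_subset_of_nonneg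
            (Finset.erase_subset _ _) fun _ _ _ => Finset.expect_nonneg fun _ _ => hG _ _
      _ = 𝔼 π : Equiv.Perm (Fin n), ∑ i', ∑ k', G (π i') (π k') := by
          simp only [hT, Finset.expect_sum_comm]
      _ = 𝔼 π : Equiv.Perm (Fin n), ∑ j, ∑ l, G j l := Finset.expect_congr rfl fun π _ => by
          rw [← Equiv.sum_comp π fun j => ∑ l, G j l]
          exact Finset.sum_congr rfl fun i' _ => Equiv.sum_comp π fun l => G (π i') l
      _ = _ := Fintype.expect_const _
  have h3 : 𝔼 j, 𝔼 l, G j l = (∑ j, ∑ l, G j l) / (n * n) := by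
    simp only [Fintype.expect_eq_sum_div_card, Fintype.card_fin, ← Finset.sum_div, div_div]
  rw [h3, ← mul_div_assoc, le_div_iff₀ (by positivity)]
  rw [h1] at h2
  have hT0 : 0 ≤ T i k := Finset.expect_nonneg fun _ _ => hG _ _
  change T i k * _ ≤ _
  nlinarith [mul_nonneg (mul_nonneg hT0 (by linarith : (0 : ℝ) ≤ n)) (sub_nonneg.2 hn')]

/-- `∑ᵢ 𝔼ⱼ min (bᵢⱼ, bᵢⱼ²)`. -/
def modular {n : ℕ} (b : Fin n → Fin n → ℝ) : ℝ := ∑ i, 𝔼 j, min (b i j) (b i j ^ 2)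

variable {n : ℕ} {b : Fin n → Fin n → ℝ}

theorem modular_nonneg (hb : ∀ i j, 0 ≤ b i j) : 0 ≤ modular b :=
  Finset.sum_nonneg fun i _ => Finset.expect_nonneg fun j _ => le_min (hb i j) (sq_nonneg _)

/-- Pointwise in `π`: with `z = min (b, b²)` one has `b² ≤ z² + z`, so `∑ b² ≤ Z² + Z ≤ (Z + 1/2)²`
for `Z = ∑ z`. -/
theorem expect_perm_sqrt_le (hb : ∀ i j, 0 ≤ b i j) :
    𝔼 π : Equiv.Perm (Fin n), √(∑ i, b i (π i) ^ 2) ≤ modular b + 1 / 2 := by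
  have h : ∀ π : Equiv.Perm (Fin n), √(∑ i, b i (π i) ^ 2)
      ≤ ∑ i, min (b i (π i)) (b i (π i) ^ 2) + 1 / 2 := fun π => by
    have hz : ∀ i, 0 ≤ min (b i (π i)) (b i (π i) ^ 2) := fun i => le_min (hb _ _) (sq_nonneg _)
    have hZ := Finset.sum_nonneg fun i (_ : i ∈ Finset.univ) => hz i
    refine Real.sqrt_le_iff.2 ⟨by positivity, ?_⟩
    have h1 : ∑ i, b i (π i) ^ 2 ≤ ∑ i, min (b i (π i)) (b i (π i) ^ 2) ^ 2
        + ∑ i, min (b i (π i)) (b i (π i) ^ 2) := by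
      rw [← Finset.sum_add_distrib]
      refine Finset.sum_le_sum fun i _ => ?_
      have := hb i (π i)
      rcases min_cases (b i (π i)) (b i (π i) ^ 2) with ⟨h, -⟩ | ⟨h, -⟩ <;> rw [h] <;> nlinarith
    have h2 : ∑ i, min (b i (π i)) (b i (π i) ^ 2) ^ 2
        ≤ (∑ i, min (b i (π i)) (b i (π i) ^ 2)) ^ 2 :=
      Finset.sum_sq_le_sq_sum_of_nonneg fun i _ => hz i
    nlinarith
  refine (Finset.expect_le_expect fun π _ => h π).trans_eq ?_
  rw [Finset.expect_add_distrib, Fintype.expect_const, Finset.expect_sum_comm]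
  exact congrArg (· + (1 : ℝ) / 2) (Finset.sum_congr rfl fun i _ =>
    expect_perm_apply i fun j => min (b i j) (b i j ^ 2))

/-- With `z = min (b, b²)` and `m = min (1, b²)` one has `z² = b² m`, so Cauchy–Schwarz bounds the
ℓ₂ norm below by `Z / √W`, where `Z = ∑ z` and `W = ∑ m`. The convex function `1 / √W` is replaced
by its tangent, which leaves only the means of `Z` and `Z W` to estimate. -/
theorem le_expect_perm_sqrt (hb : ∀ i j, 0 ≤ b i j) :
    modular b / √(1 + 2 * modular b) ≤ 𝔼 π : Equiv.Perm (Fin n), √(∑ i, b i (π i) ^ 2) := by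
  set A := modular b with hA
  have hA0 : 0 ≤ A := modular_nonneg hb
  -- The point of tangency: the mean of `Z W` is at most `A + 2 A² = A l`, so the tangent bound
  -- becomes `(3 A - A) / (2 √l)`.
  set l := 1 + 2 * A with hl
  have hl0 : 0 < l := by positivity
  have hsl : 0 < √l := Real.sqrt_pos.2 hl0
  have hsl2 : √l ^ 2 = l := Real.sq_sqrt hl0.le
  set z : Fin n → Fin n → ℝ := fun i j => min (b i j) (b i j ^ 2) with hz
  set m : Fin n → Fin n → ℝ := fun i j => min 1 (b i j ^ 2) with hm
  have hz0 : ∀ i j, 0 ≤ z i j := fun i j => le_min (hb _ _) (sq_nonneg _)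
  have hm0 : ∀ i j, 0 ≤ m i j := fun i j => le_min zero_le_one (sq_nonneg _)
  have hm1 : ∀ i j, m i j ≤ 1 := fun i j => min_le_left _ _
  have hmz : ∀ i j, m i j ≤ z i j := fun i j => by
    refine le_min ?_ (min_le_right _ _)
    rcases le_total 1 (b i j) with h | h
    · exact (hm1 i j).trans h
    · exact (min_le_right _ _).trans (by nlinarith [hb i j])
  have hzbm : ∀ i j, z i j ^ 2 = b i j ^ 2 * m i j := fun i j => by
    have := hb i j
    simp only [hz, hm]
    rcases le_total 1 (b i j) with h | h
    · rw [min_eq_left (by nlinarith), min_eq_left (by nlinarith), mul_one]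
    · rw [min_eq_right (by nlinarith), min_eq_right (by nlinarith)]
      ring
  have key : ∀ π : Equiv.Perm (Fin n), (∑ i, z i (π i)) * (3 - (∑ k, m k (π k)) / l) / (2 * √l)
      ≤ √(∑ i, b i (π i) ^ 2) := fun π => by
    set Z := ∑ i, z i (π i)
    set W := ∑ k, m k (π k)
    have hZ0 : 0 ≤ Z := Finset.sum_nonneg fun i _ => hz0 _ _
    have hW0 : 0 ≤ W := Finset.sum_nonneg fun i _ => hm0 _ _
    have hCS : Z ≤ √(∑ i, b i (π i) ^ 2) * √W := by
      have := Real.sum_sqrt_mul_sqrt_le (s := Finset.univ) (f := fun i => b i (π i) ^ 2)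
        (g := fun i => m i (π i)) (fun i => sq_nonneg _) (fun i => hm0 _ _)
      refine le_trans (Finset.sum_le_sum fun i _ => ?_) this
      rw [← Real.sqrt_mul (sq_nonneg _), ← hzbm]
      exact (Real.sqrt_sq (hz0 _ _)).ge
    have hS0 := Real.sqrt_nonneg (∑ i, b i (π i) ^ 2)
    set S := √(∑ i, b i (π i) ^ 2)
    rcases le_or_gt (3 - W / l) 0 with h | h
    · exact (div_nonpos_of_nonpos_of_nonneg (mul_nonpos_of_nonneg_of_nonpos hZ0 h)
        (by positivity)).trans hS0
    · rw [div_le_iff₀ (by positivity)]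
      refine (mul_le_mul_of_nonneg_right hCS h.le).trans ?_
      rw [mul_assoc]
      refine mul_le_mul_of_nonneg_left ?_ hS0
      set w := √W with hw
      have hw0 : 0 ≤ w := Real.sqrt_nonneg _
      have hw2 : w ^ 2 = W := Real.sq_sqrt hW0
      rw [← hw2]
      set r := √l
      rw [← hsl2, ← sub_nonneg]
      have : 2 * r - w * (3 - w ^ 2 / r ^ 2) = (w - r) ^ 2 * (w + 2 * r) / r ^ 2 := by
        field_simp
        ring
      rw [this]
      positivity
  have hZ : 𝔼 π : Equiv.Perm (Fin n), ∑ i, z i (π i) = A := by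
    rw [Finset.expect_sum_comm]
    exact Finset.sum_congr rfl fun i _ => expect_perm_apply i fun j => z i j
  have hW : ∑ k, 𝔼 j, m k j ≤ A :=
    Finset.sum_le_sum fun k _ => Finset.expect_le_expect fun j _ => hmz k j
  -- Diagonal terms contribute at most `A` because `m ≤ 1`; the others contribute at most twice the
  -- product of the means, and `m ≤ z`.
  have hZW : 𝔼 π : Equiv.Perm (Fin n), (∑ i, z i (π i)) * (∑ k, m k (π k)) ≤ A + 2 * A ^ 2 := by
    have h1 : ∀ i k, 𝔼 π : Equiv.Perm (Fin n), z i (π i) * m k (π k)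
        ≤ (if i = k then 𝔼 j, z i j else 0) + 2 * ((𝔼 j, z i j) * 𝔼 l, m k l) := fun i k => by
      have hz' : 0 ≤ 𝔼 j, z i j := Finset.expect_nonneg fun j _ => hz0 i j
      have hm' : 0 ≤ 𝔼 l, m k l := Finset.expect_nonneg fun j _ => hm0 k j
      split_ifs with h
      · subst h
        refine le_add_of_le_of_nonneg ?_ (by positivity)
        rw [← expect_perm_apply i]
        exact Finset.expect_le_expect fun π _ => mul_le_of_le_one_right (hz0 _ _) (hm1 _ _)
      · rw [zero_add]
        refine (expect_perm_apply_apply_le h (fun j l => z i j * m k l)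
          fun j l => mul_nonneg (hz0 _ _) (hm0 _ _)).trans_eq ?_
        simp only [← Finset.mul_expect, ← Finset.expect_mul]
    simp only [Finset.sum_mul_sum, Finset.expect_sum_comm]
    refine (Finset.sum_le_sum fun i _ => Finset.sum_le_sum fun k _ => h1 i k).trans ?_
    simp only [Finset.sum_add_distrib, Finset.sum_ite_eq, Finset.mem_univ, if_true,
      ← Finset.mul_sum, ← Finset.sum_mul]
    have : (∑ i, 𝔼 j, z i j) = A := rfl
    rw [this, sq]
    gcongr
  calc A / √l = (3 * A - (A + 2 * A ^ 2) / l) / (2 * √l) := by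
        rw [hl]
        field_simp
        ring
    _ ≤ (3 * A - (𝔼 π : Equiv.Perm (Fin n), (∑ i, z i (π i)) * (∑ k, m k (π k))) / l)
          / (2 * √l) := by gcongr
    _ = 𝔼 π : Equiv.Perm (Fin n),
          (∑ i, z i (π i)) * (3 - (∑ k, m k (π k)) / l) / (2 * √l) := by
        rw [← Finset.expect_div, ← hZ, Finset.mul_expect, Finset.expect_div,
          ← Finset.expect_sub_distrib]
        congr 1
        exact Finset.expect_congr rfl fun π _ => by ring
    _ ≤ _ := Finset.expect_le_expect fun π _ => key π

end RandomPermutations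

/-! ### The inverse conjugate, and rows that represent an Orlicz function -/

namespace OrliczFunction

variable (M : OrliczFunction)

theorem conj_le_iff {s y : ℝ} : M.conj s ≤ (y : EReal) ↔ ∀ t, 0 ≤ t → s * t ≤ M t + y := by
  simp only [conj, iSup_le_iff, Subtype.forall, EReal.coe_le_coe_iff]
  exact forall₂_congr fun t _ => sub_le_iff_le_add'

theorem le_conjInv {s y : ℝ} (hs : 0 ≤ s) (h : ∀ t, 0 ≤ t → s * t ≤ M t + y) :
    s ≤ M.conjInv y := by
  refine le_csSup ⟨M 1 + y, fun r hr => ?_⟩ ⟨hs, M.conj_le_iff.2 h⟩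
  simpa using M.conj_le_iff.1 hr.2 1 zero_le_one

theorem conjInv_nonneg (y : ℝ) : 0 ≤ M.conjInv y := Real.sSup_nonneg fun _ h => h.1

/-- Young's inequality: the supremum defining `M^{*-1} (y)` is attained. With `le_conjInv` it
characterizes `M^{*-1} (y)` as the largest slope `s ≥ 0` satisfying `s t ≤ M t + y` for all `t ≥ 0`.
-/
theorem conjInv_mul_le {y t : ℝ} (hy : 0 ≤ y) (ht : 0 ≤ t) : M.conjInv y * t ≤ M t + y := by
  rcases ht.eq_or_lt with rfl | ht'
  · simpa using add_nonneg (M.nonneg le_rfl) hy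
  · rw [← le_div_iff₀ ht']
    refine csSup_le ⟨0, le_rfl, M.conj_le_iff.2 fun r hr => ?_⟩ fun s hs => ?_
    · rw [zero_mul]
      exact add_nonneg (M.nonneg hr) hy
    · rw [le_div_iff₀ ht']
      exact M.conj_le_iff.1 hs.2 t ht

theorem conjInv_mono {y z : ℝ} (hy : 0 ≤ y) (hyz : y ≤ z) : M.conjInv y ≤ M.conjInv z :=
  M.le_conjInv (M.conjInv_nonneg y) fun t ht =>
    (M.conjInv_mul_le hy ht).trans (by linarith)

theorem conjInv_le_mul {y : ℝ} (hy : 1 ≤ y) : M.conjInv y ≤ y * M.conjInv 1 := by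
  have hy0 : 0 < y := by linarith
  rw [mul_comm, ← div_le_iff₀ hy0]
  refine M.le_conjInv (div_nonneg (M.conjInv_nonneg y) hy0.le) fun t ht => ?_
  rw [div_mul_eq_mul_div, div_le_iff₀ hy0]
  have := M.conjInv_mul_le hy0.le ht
  nlinarith [M.nonneg ht]

theorem conjInvSq_nonneg (y : ℝ) : 0 ≤ M.conjInvSq y := sq_nonneg _

theorem conjInvSq_mono {y z : ℝ} (hy : 0 ≤ y) (hyz : y ≤ z) : M.conjInvSq y ≤ M.conjInvSq z :=
  pow_le_pow_left₀ (M.conjInv_nonneg y) (M.conjInv_mono hy hyz) 2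

theorem add_rightDeriv_mul_le {p : ℝ} (hp : 0 < p) {t : ℝ} (ht : 0 ≤ t) :
    M p + derivWithin M (Ioi p) p * (t - p) ≤ M t := by
  have hpi : p ∈ interior (Ici (0 : ℝ)) := by simpa using hp
  rcases lt_trichotomy t p with h | rfl | h
  · have h1 := (M.convexOn'.slope_le_leftDeriv_of_mem_interior ht hpi h).trans
      (M.convexOn'.leftDeriv_le_rightDeriv_of_mem_interior hpi)
    rw [slope_def_field, div_le_iff₀ (by linarith)] at h1
    linarith
  · simp
  · have h1 := M.convexOn'.rightDeriv_le_slope_of_mem_interior hpi (ht : t ∈ Ici 0) h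
    rw [slope_def_field, le_div_iff₀ (by linarith)] at h1
    linarith

/-- Fenchel–Moreau at a point of `(0, ∞)`, through a subgradient. -/
theorem exists_eq_conjInv_mul_sub {p : ℝ} (hp : 0 < p) :
    ∃ y, 0 ≤ y ∧ M p ≤ M.conjInv y * p - y := by
  have hsub := fun (t : ℝ) (ht : 0 ≤ t) => M.add_rightDeriv_mul_le hp ht
  set σ := derivWithin M (Ioi p) p
  have hσ0 : 0 ≤ σ := by
    have h1 := hsub (p / 2) (by linarith)
    have h2 := M.mono (s := p / 2) (t := p) (by linarith) (by linarith)
    nlinarith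
  have h0 := hsub 0 le_rfl
  rw [M.map_zero'] at h0
  refine ⟨σ * p - M p, by linarith, ?_⟩
  have : σ ≤ M.conjInv (σ * p - M p) :=
    M.le_conjInv hσ0 fun t ht => by linarith [hsub t ht]
  nlinarith

/-- `N (t) = (1/n) ∑_{j < n} min (t αⱼ, (t αⱼ)²)`. -/
def rowModular (n : ℕ) (α : ℕ → ℝ) (t : ℝ) : ℝ :=
  (∑ j ∈ Finset.range n, min (t * α j) ((t * α j) ^ 2)) / n

/-- The first `n` terms of the decreasing sequence `α` represent `M`: at the points `k / n`, the
function `H = (M^{*-1})²` is, up to a factor 2, the sum of the squared mean of the first `k`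
terms and `k / n` times the mean of the squares of the others. -/
structure Represents (n : ℕ) (α : ℕ → ℝ) : Prop where
  nonneg : ∀ j < n, 0 ≤ α j
  anti : ∀ j k, j ≤ k → k < n → α k ≤ α j
  lower : ∀ k, 1 ≤ k → k ≤ n → ((∑ j ∈ Finset.range k, α j) / n) ^ 2
    + k / n * ((∑ j ∈ Finset.Ico k n, α j ^ 2) / n) ≤ M.conjInvSq (k / n)
  upper : ∀ k, 1 ≤ k → k ≤ n → M.conjInvSq (k / n) ≤
    2 * (((∑ j ∈ Finset.range k, α j) / n) ^ 2
      + k / n * ((∑ j ∈ Finset.Ico k n, α j ^ 2) / n))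

variable {M} {n : ℕ} {α : ℕ → ℝ}

theorem rowModular_nonneg (h : M.Represents n α) {t : ℝ} (ht : 0 ≤ t) :
    0 ≤ rowModular n α t :=
  div_nonneg (Finset.sum_nonneg fun j hj =>
    le_min (mul_nonneg ht (h.nonneg j (Finset.mem_range.1 hj))) (sq_nonneg _)) (Nat.cast_nonneg n)

theorem rowModular_mul_le (h : M.Represents n α) {r t : ℝ} (ht : 0 ≤ t) (hr : 0 ≤ r)
    (hr1 : r ≤ 1) : rowModular n α (r * t) ≤ r * rowModular n α t := by
  rw [rowModular, rowModular, ← mul_div_assoc, Finset.mul_sum]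
  gcongr with j hj
  have := mul_nonneg ht (h.nonneg j (Finset.mem_range.1 hj))
  rw [mul_assoc, mul_pow, mul_min_of_nonneg _ _ hr]
  refine min_le_min le_rfl (mul_le_mul_of_nonneg_right ?_ (sq_nonneg _))
  nlinarith

theorem rowModular_le_split {m : ℕ} (hm : m ≤ n) (t : ℝ) :
    rowModular n α t ≤ t * ((∑ j ∈ Finset.range m, α j) / n)
      + t ^ 2 * ((∑ j ∈ Finset.Ico m n, α j ^ 2) / n) := by
  rw [rowModular, ← Finset.sum_range_add_sum_Ico _ hm, add_div, ← mul_div_assoc,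
    ← mul_div_assoc, Finset.mul_sum, Finset.mul_sum]
  gcongr with j _ j _
  · exact min_le_left _ _
  · exact (min_le_right _ _).trans_eq (mul_pow _ _ _)

theorem rowModular_le_conjInv_mul (h : M.Represents n α) {m : ℕ} (hm1 : 1 ≤ m) (hm : m ≤ n)
    {t : ℝ} (ht : 0 ≤ t) (hN : rowModular n α t ≤ m / n) :
    rowModular n α t ≤ 2 * (M.conjInv (m / n) * t) := by
  have hs := rowModular_le_split (α := α) hm t
  have hl := h.lower m hm1 hm
  have hN0 := rowModular_nonneg h ht
  have hF0 : 0 ≤ (∑ j ∈ Finset.range m, α j) / n := div_nonneg (Finset.sum_nonneg fun j hj =>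
    h.nonneg j ((Finset.mem_range.1 hj).trans_le hm)) (Nat.cast_nonneg n)
  have hR0 : 0 ≤ (∑ j ∈ Finset.Ico m n, α j ^ 2) / n :=
    div_nonneg (Finset.sum_nonneg fun j _ => sq_nonneg _) (Nat.cast_nonneg n)
  rw [conjInvSq] at hl
  have hh := M.conjInv_nonneg (m / n)
  set N := rowModular n α t
  set F := (∑ j ∈ Finset.range m, α j) / n
  set R := (∑ j ∈ Finset.Ico m n, α j ^ 2) / n
  set y : ℝ := m / n
  set s := M.conjInv y
  have hst : 0 ≤ s * t := mul_nonneg hh ht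
  -- One of the two halves of the split carries at least `N / 2`. If it is the linear one, `F ≤ s`
  -- suffices; if it is the quadratic one, multiplying by `N ≤ y` gives `N² / 2 ≤ y t² R ≤ (s t)²`.
  rcases le_total (N / 2) (t * F) with h1 | h1
  · have : F ≤ s := by
      refine le_of_sq_le_sq ?_ hh
      have : 0 ≤ y * R := mul_nonneg (hN0.trans hN) hR0
      linarith
    nlinarith
  · have h2 : N / 2 ≤ t ^ 2 * R := by linarith
    have h3 : N * (N / 2) ≤ y * (t ^ 2 * R) := mul_le_mul hN h2 (by linarith) (hN0.trans hN)
    have h4 : y * (t ^ 2 * R) ≤ (s * t) ^ 2 := by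
      rw [mul_pow, mul_left_comm, mul_comm]
      refine mul_le_mul_of_nonneg_right ?_ (sq_nonneg t)
      linarith [sq_nonneg F]
    refine le_of_sq_le_sq ?_ (by linarith)
    nlinarith

/-- Where `M ≤ 1`, the function `N` is dominated by `M`. -/
theorem rowModular_div_four_le (h : M.Represents n α) (hn : 1 ≤ n) {t : ℝ} (ht : 0 ≤ t)
    (hM : M t ≤ 1) : rowModular n α (t / 4) ≤ M t + 1 / n := by
  have hn0 : (0 : ℝ) < n := by exact_mod_cast hn
  have h1 : rowModular n α t ≤ 2 := by
    have hs := rowModular_le_split (α := α) (le_refl n) t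
    have hl := h.lower n hn le_rfl
    simp only [Finset.Ico_self, Finset.sum_empty, zero_div, mul_zero, add_zero,
      div_self hn0.ne'] at hs hl
    have h2 := le_of_sq_le_sq hl (M.conjInv_nonneg 1)
    have h3 := M.conjInv_mul_le zero_le_one ht
    nlinarith
  have h4 : rowModular n α (t / 4) ≤ 1 / 4 * rowModular n α t := by
    rw [div_eq_inv_mul, inv_eq_one_div]
    exact rowModular_mul_le h ht (by norm_num) (by norm_num)
  have hN0 := rowModular_nonneg h (t := t / 4) (by linarith)
  -- The dilation by 4 keeps the index `m` at most `n`, and makes `N ≤ (M t + m / n) / 2` with `m /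
  -- n ≤ N + 1 / n`, so that the `N` on the right can be absorbed.
  set N := rowModular n α (t / 4) with hN
  set m := max 1 ⌈n * N⌉₊ with hm
  have hmn : m ≤ n := by
    refine max_le hn (Nat.ceil_le.2 ?_)
    nlinarith
  have hNm : N ≤ m / n := by
    rw [le_div_iff₀ hn0, mul_comm]
    exact (Nat.le_ceil _).trans (by exact_mod_cast le_max_right _ _)
  have hmN : (m : ℝ) / n ≤ N + 1 / n := by
    have : (m : ℝ) ≤ n * N + 1 := by
      rw [hm, Nat.cast_max, Nat.cast_one]
      exact max_le (by nlinarith) (Nat.ceil_lt_add_one (by positivity)).le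
    rw [div_le_iff₀ hn0, add_mul, one_div_mul_cancel hn0.ne', mul_comm N]
    exact this
  have h5 := rowModular_le_conjInv_mul h (le_max_left 1 _) hmn (by linarith : 0 ≤ t / 4) hNm
  have h6 := M.conjInv_mul_le (y := m / n) (by positivity) ht
  rw [← hN] at h5
  linarith

/-- Large terms: `u ≤ min (u, u²) + 1`. Small terms: monotonicity gives `m α j ≤ F` for `j ≥ m`,
which bounds `m (t α j)²` by `(m + t F) min (t α j, (t α j)²)`. Both parts of `H (m / n)` are thus
controlled by `N`. -/
theorem conjInv_mul_le_rowModular (h : M.Represents n α) {m : ℕ} (hm1 : 1 ≤ m) (hm : m ≤ n)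
    {t : ℝ} (ht : 0 ≤ t) :
    M.conjInv (m / n) * t ≤ 2 * (rowModular n α t + m / n) := by
  have hn0 : (0 : ℝ) < n := by exact_mod_cast hm1.trans hm
  have hm0 : (0 : ℝ) < m := by exact_mod_cast hm1
  have hN0 := rowModular_nonneg h ht
  have hu := h.upper m hm1 hm
  have hF0 : 0 ≤ ∑ j ∈ Finset.range m, α j := Finset.sum_nonneg fun j hj =>
    h.nonneg j ((Finset.mem_range.1 hj).trans_le hm)
  have hα : ∀ j < n, 0 ≤ t * α j := fun j hj => mul_nonneg ht (h.nonneg j hj)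
  have hmin : ∀ j < n, 0 ≤ min (t * α j) ((t * α j) ^ 2) :=
    fun j hj => le_min (hα j hj) (sq_nonneg _)
  set N := rowModular n α t with hN
  have hNn : ∑ j ∈ Finset.range n, min (t * α j) ((t * α j) ^ 2) = n * N := by
    rw [hN, rowModular, mul_div_cancel₀ _ hn0.ne']
  set F := ∑ j ∈ Finset.range m, α j with hF
  have hF1 : t * F ≤ n * N + m := by
    rw [← hNn, hF, Finset.mul_sum]
    calc ∑ j ∈ Finset.range m, t * α j
        ≤ ∑ j ∈ Finset.range m, (min (t * α j) ((t * α j) ^ 2) + 1) := by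
          refine Finset.sum_le_sum fun j hj => ?_
          have := hα j ((Finset.mem_range.1 hj).trans_le hm)
          rcases min_cases (t * α j) ((t * α j) ^ 2) with ⟨h, -⟩ | ⟨h, h'⟩ <;> rw [h]
          · linarith
          · nlinarith [sq_nonneg (t * α j - 1)]
      _ = ∑ j ∈ Finset.range m, min (t * α j) ((t * α j) ^ 2) + m := by
          simp [Finset.sum_add_distrib]
      _ ≤ _ := by
          refine add_le_add_left (Finset.sum_le_sum_of_subset_of_nonneg (Finset.range_mono hm)
            fun j hj _ => hmin j (Finset.mem_range.1 hj)) _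
  have hR1 : m * (t ^ 2 * ∑ j ∈ Finset.Ico m n, α j ^ 2) ≤ (m + t * F) * (n * N) := by
    have h1 : ∀ j ∈ Finset.Ico m n, m * (t * α j) ^ 2
        ≤ (m + t * F) * min (t * α j) ((t * α j) ^ 2) := fun j hj => by
      obtain ⟨hmj, hjn⟩ := Finset.mem_Ico.1 hj
      have h0 := hα j hjn
      have hmF : m * α j ≤ F := by
        have := Finset.card_nsmul_le_sum (Finset.range m) α (α j) fun i hi =>
          h.anti i j ((Finset.mem_range.1 hi).le.trans hmj) hjn
        simpa using this
      have hmF' : m * (t * α j) ≤ t * F := by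
        rw [mul_left_comm]
        exact mul_le_mul_of_nonneg_left hmF ht
      have htF : 0 ≤ t * F := mul_nonneg ht hF0
      rcases min_cases (t * α j) ((t * α j) ^ 2) with ⟨h, -⟩ | ⟨h, h'⟩ <;> rw [h]
      · nlinarith
      · nlinarith [mul_nonneg htF (sq_nonneg (t * α j))]
    calc m * (t ^ 2 * ∑ j ∈ Finset.Ico m n, α j ^ 2)
        = ∑ j ∈ Finset.Ico m n, m * (t * α j) ^ 2 := by
          simp only [Finset.mul_sum, mul_pow]
      _ ≤ ∑ j ∈ Finset.Ico m n, (m + t * F) * min (t * α j) ((t * α j) ^ 2) :=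
          Finset.sum_le_sum h1
      _ = (m + t * F) * ∑ j ∈ Finset.Ico m n, min (t * α j) ((t * α j) ^ 2) :=
          (Finset.mul_sum _ _ _).symm
      _ ≤ (m + t * F) * (n * N) := by
          rw [← hNn]
          refine mul_le_mul_of_nonneg_left ?_ (by positivity)
          refine Finset.sum_le_sum_of_subset_of_nonneg ?_
            fun j hj _ => hmin j (Finset.mem_range.1 hj)
          intro j hj
          exact Finset.mem_range.2 (Finset.mem_Ico.1 hj).2
  set R := ∑ j ∈ Finset.Ico m n, α j ^ 2
  refine le_of_sq_le_sq ?_ (by positivity)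
  rw [conjInvSq] at hu
  have h2 : (M.conjInv (m / n) * t) ^ 2 ≤ 2 * ((t * F) ^ 2 + m * (t ^ 2 * R)) / n ^ 2 := by
    calc (M.conjInv (m / n) * t) ^ 2 = M.conjInv (m / n) ^ 2 * t ^ 2 := mul_pow _ _ _
      _ ≤ 2 * ((F / n) ^ 2 + m / n * (R / n)) * t ^ 2 := by gcongr
      _ = _ := by
        field_simp
  refine h2.trans ?_
  rw [div_le_iff₀ (by positivity)]
  have h3 : (2 * (N + m / n)) ^ 2 * n ^ 2 = 4 * (n * N + m) ^ 2 := by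
    field_simp
    ring
  rw [h3]
  have h4 : (t * F) ^ 2 ≤ (n * N + m) ^ 2 := by
    have : 0 ≤ t * F := by positivity
    gcongr
  have h5 : (m + t * F) * (n * N) ≤ (m + (n * N + m)) * (n * N) := by gcongr
  nlinarith [sq_nonneg (m : ℝ)]

/-- Where `N ≤ 1`, the function `M` is dominated by `N`. -/
theorem map_div_four_le (h : M.Represents n α) (hn : 1 ≤ n) {t : ℝ} (ht : 0 ≤ t)
    (hN : rowModular n α t ≤ 1) : M (t / 4) ≤ rowModular n α t + 1 / n := by
  have hn0 : (0 : ℝ) < n := by exact_mod_cast hn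
  have hN0 := rowModular_nonneg h ht
  have hn1 : (0 : ℝ) ≤ 1 / n := by positivity
  rcases ht.eq_or_lt with rfl | ht'
  · rw [zero_div, M.map_zero']
    linarith
  obtain ⟨y, hy0, hy⟩ := M.exists_eq_conjInv_mul_sub (p := t / 4) (by linarith)
  refine hy.trans ?_
  rcases le_or_gt y 1 with hy1 | hy1
  · set m := max 1 ⌈n * y⌉₊ with hm
    have hmn : m ≤ n := by
      refine max_le hn (Nat.ceil_le.2 ?_)
      nlinarith
    have hym : y ≤ m / n := by
      rw [le_div_iff₀ hn0, mul_comm]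
      exact (Nat.le_ceil _).trans (by exact_mod_cast le_max_right _ _)
    have hmy : (m : ℝ) / n ≤ y + 1 / n := by
      have : (m : ℝ) ≤ n * y + 1 := by
        rw [hm, Nat.cast_max, Nat.cast_one]
        exact max_le (by nlinarith) (Nat.ceil_lt_add_one (by positivity)).le
      rw [div_le_iff₀ hn0, add_mul, one_div_mul_cancel hn0.ne', mul_comm y]
      exact this
    have h1 := conjInv_mul_le_rowModular h (le_max_left 1 _) hmn ht
    have h2 := M.conjInv_mono hy0 hym
    have h3 := mul_le_mul_of_nonneg_right h2 ht
    have h4 : M.conjInv y * (t / 4) ≤ (rowModular n α t + m / n) / 2 := by linarith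
    have h5 : 0 ≤ (m : ℝ) / n := hy0.trans hym
    linarith
  -- For `y > 1` the grid ends, but `M^{*-1} (1) t ≤ 4` and `M^{*-1} (y) ≤ y M^{*-1} (1)` already
  -- make `M^{*-1} (y) t / 4 - y` nonpositive.
  · have h1 := conjInv_mul_le_rowModular h hn le_rfl ht
    rw [div_self hn0.ne'] at h1
    have h2 := mul_le_mul_of_nonneg_right (M.conjInv_le_mul hy1.le) (by linarith : 0 ≤ t / 4)
    have h3 : y * (M.conjInv 1 * t) ≤ y * 4 := mul_le_mul_of_nonneg_left (by linarith) hy0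
    linarith

end OrliczFunction

/-! ### Concavity of `H`, and representing rows for general 2-concave functions -/

namespace OrliczFunction

variable {M : OrliczFunction}

/-- Let `sᵢ = M^{*-1} (yᵢ)` and `r² = a s₁² + b s₂²`. To test the slope `r` at `t`, apply Young's
inequality at `t sᵢ / r`: the weighted squares of these points add up to `t²`, so 2-concavity bounds
the weighted values of `M` by `M t`, while the weighted products `sᵢ (t sᵢ / r)` add up to `r t`. -/
theorem concaveOn_conjInvSq (hM : M.IsTwoConcave) : ConcaveOn ℝ (Ici 0) M.conjInvSq := by
  refine ⟨convex_Ici 0, fun y₁ hy₁ y₂ hy₂ a b ha hb hab => ?_⟩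
  simp only [smul_eq_mul]
  set v := a * M.conjInvSq y₁ + b * M.conjInvSq y₂ with hv
  have hv0 : 0 ≤ v := by
    have := M.conjInvSq_nonneg y₁
    have := M.conjInvSq_nonneg y₂
    positivity
  rcases hv0.eq_or_lt with h0 | hpos
  · rw [← h0]
    exact M.conjInvSq_nonneg _
  set r := √v with hr
  have hr0 : 0 < r := Real.sqrt_pos.2 hpos
  have hr2 : r ^ 2 = v := Real.sq_sqrt hv0
  suffices h : r ≤ M.conjInv (a * y₁ + b * y₂) by
    rw [← hr2]
    exact pow_le_pow_left₀ hr0.le h 2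
  refine M.le_conjInv hr0.le fun t ht => ?_
  set s₁ := M.conjInv y₁ with hs₁
  set s₂ := M.conjInv y₂ with hs₂
  have hs₁0 : 0 ≤ s₁ := M.conjInv_nonneg y₁
  have hs₂0 : 0 ≤ s₂ := M.conjInv_nonneg y₂
  have hv' : v = a * s₁ ^ 2 + b * s₂ ^ 2 := rfl
  have hp₁ : 0 ≤ t * s₁ / r := by positivity
  have hp₂ : 0 ≤ t * s₂ / r := by positivity
  have h₁ := M.conjInv_mul_le (mem_Ici.1 hy₁) hp₁
  have h₂ := M.conjInv_mul_le (mem_Ici.1 hy₂) hp₂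
  have hc := hM.2 (mem_Ici.2 (sq_nonneg (t * s₁ / r))) (mem_Ici.2 (sq_nonneg (t * s₂ / r)))
    ha hb hab
  simp only [smul_eq_mul, Real.sqrt_sq hp₁, Real.sqrt_sq hp₂] at hc
  have e : a * (t * s₁ / r) ^ 2 + b * (t * s₂ / r) ^ 2 = t ^ 2 := by
    have : a * (t * s₁ / r) ^ 2 + b * (t * s₂ / r) ^ 2
        = t ^ 2 * (a * s₁ ^ 2 + b * s₂ ^ 2) / r ^ 2 := by
      field_simp
    rw [this, ← hv', hr2, mul_div_cancel_right₀ _ hpos.ne']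
  rw [e, Real.sqrt_sq ht] at hc
  have e' : a * (s₁ * (t * s₁ / r)) + b * (s₂ * (t * s₂ / r)) = r * t := by
    have : a * (s₁ * (t * s₁ / r)) + b * (s₂ * (t * s₂ / r))
        = t * (a * s₁ ^ 2 + b * s₂ ^ 2) / r := by
      field_simp
    rw [this, ← hv', ← hr2]
    field_simp
  rw [← e']
  have h₁' := mul_le_mul_of_nonneg_left h₁ ha
  have h₂' := mul_le_mul_of_nonneg_left h₂ hb
  linarith

/-- A solution of `η k = (F k)² + k ∑_{k ≤ j < n} (F (j + 1) - F j)²` for a concave sequence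
`η`. -/
theorem exists_concave_solution {n : ℕ} (hn : 1 ≤ n) (η : ℕ → ℝ) (h0 : η 0 = 0)
    (hnn : ∀ k, 0 ≤ η k) (hmono : ∀ k, k + 1 ≤ n → η k ≤ η (k + 1))
    (hconc : ∀ k, k + 2 ≤ n → η k + η (k + 2) ≤ 2 * η (k + 1))
    (hstar : ∀ k, k + 1 ≤ n → k * η (k + 1) ≤ (k + 1) * η k) :
    ∃ F : ℕ → ℝ, F 0 = 0 ∧ (∀ k, k + 2 ≤ n → F (k + 2) - F (k + 1) ≤ F (k + 1) - F k) ∧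
      F (n - 1) ≤ F n ∧
      ∀ k ≤ n, η k = F k ^ 2 + k * ∑ j ∈ Finset.Ico k n, (F (j + 1) - F j) ^ 2 := by
  -- `β k ²` is the intercept at 0 of the chord of `η` over `[k, k + 1]`, the discrete `H - t H'`.
  -- The identity sought amounts to `(k + 1) F k - k F (k + 1) = β k`, solved backwards from `F n =
  -- √(η n)`. Concavity of `η` makes `β` increase, and `β (k + 1) - β k` is `k + 1` times minus the
  -- second difference of `F`.
  set β : ℕ → ℝ := fun k => √((k + 1) * η k - k * η (k + 1)) with hβ
  have hβ0 : ∀ k, 0 ≤ β k := fun k => Real.sqrt_nonneg _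
  have hβ2 : ∀ k, k + 1 ≤ n → β k ^ 2 = (k + 1) * η k - k * η (k + 1) := fun k hk =>
    Real.sq_sqrt (sub_nonneg.2 (hstar k hk))
  set F : ℕ → ℝ := fun k => k * (√(η n) / n + ∑ j ∈ Finset.Ico k n, β j / (j * (j + 1)))
    with hF
  have hFβ : ∀ k, k + 1 ≤ n → (k + 1) * F k - k * F (k + 1) = β k := fun k hk => by
    rcases Nat.eq_zero_or_pos k with rfl | hk0
    · simp [hF, hβ, h0]
    · have hk0' : (0 : ℝ) < k := by exact_mod_cast hk0
      simp only [hF]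
      rw [Finset.sum_eq_sum_Ico_succ_bot (by omega : k < n)]
      push_cast
      field_simp
      ring
  have hFn : F n = √(η n) := by
    have : (n : ℝ) ≠ 0 := by positivity
    simp only [hF, Finset.Ico_self, Finset.sum_empty, add_zero]
    field_simp
  refine ⟨F, by simp [hF], fun k hk => ?_, ?_, fun k hk => ?_⟩
  · have h1 := hFβ k (by omega)
    have h2 := hFβ (k + 1) (by omega)
    have h3 : β k ≤ β (k + 1) := by
      refine Real.sqrt_le_sqrt ?_
      push_cast
      nlinarith [hconc k hk, (Nat.cast_nonneg k : (0 : ℝ) ≤ k)]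
    push_cast at h2
    have hk0 : (0 : ℝ) < k + 1 := by positivity
    have h4 : 0 ≤ (k + 1 : ℝ) * ((F (k + 1) - F k) - (F (k + 2) - F (k + 1))) := by
      have : k + 1 + 1 = k + 2 := rfl
      rw [this] at h2
      linarith
    linarith [nonneg_of_mul_nonneg_right h4 hk0]
  · obtain ⟨k, rfl⟩ : ∃ k, n = k + 1 := ⟨n - 1, by omega⟩
    have h1 := hFβ k le_rfl
    have h2 : β k ≤ F (k + 1) := by
      rw [hFn]
      refine Real.sqrt_le_sqrt ?_
      nlinarith [hmono k le_rfl, (Nat.cast_nonneg k : (0 : ℝ) ≤ k)]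
    have hk0 : (0 : ℝ) < k + 1 := by positivity
    rw [Nat.add_sub_cancel]
    nlinarith
  · induction hk using Nat.decreasingInduction with
    | self => simp [hFn, Real.sq_sqrt (hnn n)]
    | of_succ k hk ih =>
      rw [Finset.sum_eq_sum_Ico_succ_bot (by omega : k < n)]
      have h1 := hFβ k hk
      have h2 := hβ2 k hk
      rw [← h1] at h2
      have hk0 : (0 : ℝ) < k + 1 := by positivity
      push_cast at ih
      refine mul_left_cancel₀ hk0.ne' ?_
      rw [ih] at h2
      linear_combination -h2

theorem exists_represents (hM : M.IsTwoConcave) {n : ℕ} (hn : 1 ≤ n) :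
    ∃ α, M.Represents n α := by
  have hn0 : (0 : ℝ) < n := by exact_mod_cast hn
  have hH := concaveOn_conjInvSq hM
  have hpos : ∀ k : ℕ, (0 : ℝ) ≤ k / n := fun k => by positivity
  -- `H 0` is positive when `M` has positive slope at 0. Lowering the value at 0 to 0 preserves
  -- concavity and monotonicity, and `Represents` only looks at `k ≥ 1`.
  set η : ℕ → ℝ := fun k => if k = 0 then 0 else M.conjInvSq (k / n) with hη
  have hη0 : ∀ k, 0 ≤ η k := fun k => by
    simp only [hη]
    split_ifs
    exacts [le_rfl, M.conjInvSq_nonneg _]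
  have hηle : ∀ k, η k ≤ M.conjInvSq (k / n) := fun k => by
    simp only [hη]
    split_ifs
    exacts [M.conjInvSq_nonneg _, le_rfl]
  have hηs : ∀ k, η (k + 1) = M.conjInvSq ((k + 1 : ℕ) / n) := fun k => by simp [hη]
  obtain ⟨F, hF0, hFc, hFn, hF⟩ := exists_concave_solution hn η (by simp [hη]) hη0
    (fun k _ => by
      rw [hηs]
      refine (hηle k).trans (M.conjInvSq_mono (hpos k) ?_)
      gcongr
      omega)
    (fun k _ => by
      have h := hH.2 (mem_Ici.2 (hpos k)) (mem_Ici.2 (hpos (k + 2)))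
        (by norm_num : (0 : ℝ) ≤ 1 / 2) (by norm_num : (0 : ℝ) ≤ 1 / 2) (by norm_num)
      have e : (1 / 2 : ℝ) • ((k : ℝ) / n) + (1 / 2 : ℝ) • (((k + 2 : ℕ) : ℝ) / n)
          = ((k + 1 : ℕ) : ℝ) / n := by
        simp only [smul_eq_mul]
        push_cast
        ring
      rw [e, smul_eq_mul, smul_eq_mul] at h
      rw [hηs k, hηs (k + 1)]
      have := hηle k
      change _ + M.conjInvSq ((k + 2 : ℕ) / n) ≤ _
      linarith)
    (fun k _ => by
      rcases Nat.eq_zero_or_pos k with rfl | hk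
      · simp [hη]
      have hk1 : (0 : ℝ) < k + 1 := by positivity
      have h := hH.2 (mem_Ici.2 le_rfl) (mem_Ici.2 (hpos (k + 1)))
        (by positivity : (0 : ℝ) ≤ 1 / (k + 1)) (by positivity : (0 : ℝ) ≤ k / (k + 1))
        (by field_simp; ring)
      have e : (1 / (k + 1) : ℝ) • (0 : ℝ) + (k / (k + 1) : ℝ) • (((k + 1 : ℕ) : ℝ) / n)
          = (k : ℝ) / n := by
        simp only [smul_eq_mul]
        push_cast
        field_simp
        ring
      rw [e, smul_eq_mul, smul_eq_mul] at h
      have e2 : η k = M.conjInvSq (k / n) := by simp [hη, hk.ne']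
      rw [hηs, e2]
      have h3 : (k / (k + 1) : ℝ) * M.conjInvSq ((k + 1 : ℕ) / n) ≤ M.conjInvSq (k / n) :=
        le_trans (le_add_of_nonneg_left
          (mul_nonneg (by positivity) (M.conjInvSq_nonneg 0))) h
      rw [div_mul_eq_mul_div, div_le_iff₀ hk1] at h3
      linarith)
  have hd : ∀ j k, j ≤ k → k < n → F (k + 1) - F k ≤ F (j + 1) - F j := fun j k hjk => by
    induction k, hjk using Nat.le_induction with
    | base => exact fun _ => le_rfl
    | succ k _ ih => exact fun hk => (hFc k (by omega)).trans (ih (by omega))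
  have hsum : ∀ k, (∑ j ∈ Finset.range k, n * (F (j + 1) - F j)) / n = F k := fun k => by
    rw [← Finset.mul_sum, Finset.sum_range_sub, hF0, sub_zero, mul_div_cancel_left₀ _ hn0.ne']
  have hid : ∀ k, 1 ≤ k → k ≤ n →
      ((∑ j ∈ Finset.range k, n * (F (j + 1) - F j)) / n) ^ 2
      + k / n * ((∑ j ∈ Finset.Ico k n, (n * (F (j + 1) - F j)) ^ 2) / n)
      = M.conjInvSq (k / n) := fun k hk1 hkn => by
    have h1 := hF k hkn
    have h2 : η k = M.conjInvSq (k / n) := by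
      simp only [hη]
      rw [if_neg (by omega)]
    rw [hsum, ← h2, h1]
    simp only [mul_pow, ← Finset.mul_sum]
    field_simp
  refine ⟨fun j => n * (F (j + 1) - F j), fun j hj => mul_nonneg hn0.le ?_,
    fun j k hjk hk => mul_le_mul_of_nonneg_left (hd j k hjk hk) hn0.le,
    fun k hk1 hkn => (hid k hk1 hkn).le, fun k hk1 hkn => ?_⟩
  · have := hd j (n - 1) (by omega) (by omega)
    rw [Nat.sub_add_cancel hn] at this
    linarith
  · rw [hid k hk1 hkn]
    linarith [M.conjInvSq_nonneg (k / n)]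

end OrliczFunction

/-! ### Regular Orlicz functions: differentiability of `M^{*-1}` and `H` -/

namespace OrliczFunction

/-- The regularity of the Orlicz functions that the explicit embedding depends on. -/
structure IsRegular (M : OrliczFunction) : Prop where
  twice : M.IsTwiceDifferentiable
  deriv_deriv_pos : ∀ t : ℝ, 0 < t → 0 < deriv (deriv M) t
  tendsto_div : Tendsto (fun t : ℝ => M t / t) (𝓝[>] 0) (𝓝 0)
  strict : M.IsStrictlyTwoConcave

/-- `t M'(t) - M (t)`, which is `M^* (M' (t))`. -/
def legendre (M : OrliczFunction) (t : ℝ) : ℝ := t * deriv M t - M t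

open Classical in
/-- The function `y ↦ 1 / t` where `t M'(t) - M (t) = y`, with value `0` where there is no such
`t`.  It is the derivative of `M^{*-1}`. -/
def conjInvDeriv (M : OrliczFunction) (y : ℝ) : ℝ :=
  if h : ∃ t, 0 < t ∧ M.legendre t = y then (h.choose)⁻¹ else 0

namespace IsRegular

variable {M : OrliczFunction}

theorem isTwoConcave (hM : M.IsRegular) : M.IsTwoConcave := hM.strict.concaveOn

theorem tangent_le (hM : M.IsRegular) {p t : ℝ} (hp : 0 < p) (ht : 0 ≤ t) :
    M p + deriv M p * (t - p) ≤ M t := by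
  have := M.add_rightDeriv_mul_le hp ht
  rwa [(hM.twice p hp).1.derivWithin (uniqueDiffWithinAt_Ioi p)] at this

/-- For the strictly concave function `u ↦ M (√u)`, the tangent at `t²`, of slope `M'(t) / (2 t)`,
is flatter than the chord from 0. -/
theorem mul_deriv_lt (hM : M.IsRegular) {t : ℝ} (ht : 0 < t) : t * deriv M t < 2 * M t := by
  have ht2 : (0 : ℝ) < t ^ 2 := by positivity
  have hd : HasDerivAt (fun u => M (√u)) (deriv M t * (1 / (2 * t))) (t ^ 2) := by
    have h1 := Real.hasDerivAt_sqrt ht2.ne'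
    rw [Real.sqrt_sq ht.le] at h1
    have h2 : HasDerivAt M (deriv M t) (√(t ^ 2)) := by
      rw [Real.sqrt_sq ht.le]
      exact (hM.twice t ht).1.hasDerivAt
    exact h2.comp _ h1
  have h := hM.strict.lt_slope_of_hasDerivAt (mem_Ici.2 le_rfl) (mem_Ici.2 ht2.le) ht2 hd
  rw [slope_def_field, lt_div_iff₀ (by linarith)] at h
  simp only [Real.sqrt_sq ht.le, Real.sqrt_zero, M.map_zero', sub_zero] at h
  have e : deriv M t * (1 / (2 * t)) * t ^ 2 = t * deriv M t / 2 := by field_simp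
  linarith

theorem hasDerivAt_legendre (hM : M.IsRegular) {t : ℝ} (ht : 0 < t) :
    HasDerivAt M.legendre (t * deriv (deriv M) t) t := by
  have h := ((hasDerivAt_id t).mul (hM.twice t ht).2.hasDerivAt).sub (hM.twice t ht).1.hasDerivAt
  exact h.congr_deriv (by simp)

theorem continuousOn_legendre (hM : M.IsRegular) : ContinuousOn M.legendre (Ioi 0) :=
  fun _ ht => (hM.hasDerivAt_legendre ht).continuousAt.continuousWithinAt

theorem strictMonoOn_legendre (hM : M.IsRegular) : StrictMonoOn M.legendre (Ioi 0) := by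
  refine strictMonoOn_of_deriv_pos (convex_Ioi 0) hM.continuousOn_legendre fun t ht => ?_
  rw [interior_Ioi] at ht
  rw [(hM.hasDerivAt_legendre ht).deriv]
  exact mul_pos ht (hM.deriv_deriv_pos t ht)

theorem legendre_nonneg (hM : M.IsRegular) {t : ℝ} (ht : 0 < t) : 0 ≤ M.legendre t := by
  have := hM.tangent_le ht le_rfl
  rw [M.map_zero'] at this
  rw [legendre]
  linarith

theorem exists_legendre_lt (hM : M.IsRegular) {y : ℝ} (hy : 0 < y) :
    ∃ t, 0 < t ∧ M.legendre t < y := by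
  have hM1 := M.pos' 1 one_pos
  set t := min 1 (y / (2 * M 1)) with ht
  have ht0 : 0 < t := lt_min one_pos (by positivity)
  refine ⟨t, ht0, ?_⟩
  have h1 := hM.mul_deriv_lt ht0
  have h2 := M.map_mul_le ht0.le (min_le_left _ _) zero_le_one
  rw [mul_one] at h2
  have h3 : t * M 1 ≤ y / 2 := by
    have : t ≤ y / (2 * M 1) := min_le_right _ _
    rw [le_div_iff₀ (by positivity)] at this
    linarith
  rw [legendre]
  linarith

theorem exists_legendre_eq (hM : M.IsRegular) {y T : ℝ} (hy : 0 < y) (hT : 0 < T)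
    (h : y ≤ M.legendre T) : ∃ t, 0 < t ∧ M.legendre t = y := by
  obtain ⟨s, hs, hsy⟩ := hM.exists_legendre_lt hy
  exact (convex_Ioi (0 : ℝ)).isPreconnected.intermediate_value hs hT hM.continuousOn_legendre
    ⟨hsy.le, h⟩

theorem conjInv_legendre (hM : M.IsRegular) {t : ℝ} (ht : 0 < t) :
    M.conjInv (M.legendre t) = deriv M t := by
  have h0 := hM.legendre_nonneg ht
  refine le_antisymm ?_ (M.le_conjInv ?_ fun s hs => ?_)
  · have := M.conjInv_mul_le h0 ht.le
    have e : M t + M.legendre t = deriv M t * t := by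
      rw [legendre]
      ring
    rw [e] at this
    exact le_of_mul_le_mul_right this ht
  · rw [legendre] at h0
    have := M.nonneg ht.le
    exact nonneg_of_mul_nonneg_right (by linarith) ht
  · have := hM.tangent_le ht hs
    rw [legendre]
    linarith

theorem conjInvDeriv_legendre (hM : M.IsRegular) {t : ℝ} (ht : 0 < t) :
    M.conjInvDeriv (M.legendre t) = t⁻¹ := by
  have h : ∃ s, 0 < s ∧ M.legendre s = M.legendre t := ⟨t, ht, rfl⟩
  rw [conjInvDeriv, dif_pos h]
  exact congrArg _ (hM.strictMonoOn_legendre.injOn h.choose_spec.1 ht h.choose_spec.2)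

theorem conjInvDeriv_of_forall_lt {y : ℝ}
    (h : ∀ t, 0 < t → M.legendre t < y) : M.conjInvDeriv y = 0 :=
  dif_neg fun ⟨t, ht, e⟩ => (h t ht).ne e

/-- Every `y > 0` is a value of the Legendre function, or an upper bound of it. -/
theorem eq_legendre_or (hM : M.IsRegular) {y : ℝ} (hy : 0 < y) :
    (∃ t, 0 < t ∧ M.legendre t = y) ∨ ∀ t, 0 < t → M.legendre t < y := by
  by_cases h : ∃ t, 0 < t ∧ M.legendre t = y
  · exact Or.inl h
  · exact Or.inr fun t ht => lt_of_not_ge fun h' => h (hM.exists_legendre_eq hy ht h')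

theorem conjInvDeriv_nonneg (hM : M.IsRegular) {y : ℝ} (hy : 0 < y) : 0 ≤ M.conjInvDeriv y := by
  rcases hM.eq_legendre_or hy with ⟨t, ht, rfl⟩ | h
  · rw [hM.conjInvDeriv_legendre ht]
    positivity
  · rw [conjInvDeriv_of_forall_lt h]

theorem conjInvDeriv_lt_iff (hM : M.IsRegular) {y t : ℝ} (hy : 0 < y) (ht : 0 < t) :
    M.conjInvDeriv y < t⁻¹ ↔ M.legendre t < y := by
  rcases hM.eq_legendre_or hy with ⟨s, hs, rfl⟩ | h
  · rw [hM.conjInvDeriv_legendre hs, inv_lt_inv₀ hs ht, hM.strictMonoOn_legendre.lt_iff_lt ht hs]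
  · rw [conjInvDeriv_of_forall_lt h]
    exact ⟨fun _ => h t ht, fun _ => by positivity⟩

theorem lt_conjInvDeriv_iff (hM : M.IsRegular) {y t : ℝ} (hy : 0 < y) (ht : 0 < t) :
    t⁻¹ < M.conjInvDeriv y ↔ y < M.legendre t := by
  rcases hM.eq_legendre_or hy with ⟨s, hs, rfl⟩ | h
  · rw [hM.conjInvDeriv_legendre hs, inv_lt_inv₀ ht hs, hM.strictMonoOn_legendre.lt_iff_lt hs ht]
  · rw [conjInvDeriv_of_forall_lt h]
    exact ⟨fun h' => absurd h' (not_lt.2 (by positivity)), fun h' => absurd h' (h t ht).not_gt⟩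

theorem continuousAt_conjInvDeriv (hM : M.IsRegular) {y : ℝ} (hy : 0 < y) :
    ContinuousAt M.conjInvDeriv y := by
  refine tendsto_order.2 ⟨fun w hw => ?_, fun w (hw : _ < w) => ?_⟩
  · rcases lt_or_ge w 0 with h0 | h0
    · filter_upwards [lt_mem_nhds hy] with z hz
      exact h0.trans_le (hM.conjInvDeriv_nonneg hz)
    · obtain ⟨v, hwv, hv⟩ := exists_between hw
      have hv0 : 0 < v⁻¹ := inv_pos.2 (h0.trans_lt hwv)
      rw [← inv_inv v, hM.lt_conjInvDeriv_iff hy hv0] at hv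
      filter_upwards [lt_mem_nhds hy, gt_mem_nhds hv] with z hz hz'
      refine hwv.trans ?_
      rwa [← inv_inv v, hM.lt_conjInvDeriv_iff hz hv0]
  · have hw0 : 0 < w⁻¹ := inv_pos.2 ((hM.conjInvDeriv_nonneg hy).trans_lt hw)
    rw [← inv_inv w, hM.conjInvDeriv_lt_iff hy hw0] at hw
    filter_upwards [lt_mem_nhds hy, lt_mem_nhds hw] with z hz hz'
    rwa [← inv_inv w, hM.conjInvDeriv_lt_iff hz hw0]

/-- `M^{*-1}` is below its tangents. -/
theorem conjInv_le_tangent (hM : M.IsRegular) {y z : ℝ} (hy : 0 < y) (hz : 0 < z) :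
    M.conjInv z ≤ M.conjInv y + (z - y) * M.conjInvDeriv y := by
  rcases hM.eq_legendre_or hy with ⟨t, ht, rfl⟩ | h
  · rw [hM.conjInvDeriv_legendre ht, hM.conjInv_legendre ht]
    have h1 := M.conjInv_mul_le hz.le ht.le
    rw [← le_div_iff₀ ht] at h1
    refine h1.trans_eq ?_
    rw [legendre]
    field_simp
    ring
  · rw [conjInvDeriv_of_forall_lt h, mul_zero, add_zero]
    refine M.le_conjInv (M.conjInv_nonneg z) fun t ht => ?_
    have key : ∀ T, 0 < T → M.conjInv z * t ≤ M t + y + t * z * T⁻¹ := fun T hT => by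
      have h1 := hM.tangent_le hT ht
      have h2 := h T hT
      have h3 := hM.legendre_nonneg hT
      have h4 := M.conjInv_mul_le hz.le hT.le
      rw [legendre] at h2 h3
      have h5 : M.conjInv z ≤ deriv M T + z * T⁻¹ := by
        refine le_of_mul_le_mul_right ?_ hT
        rw [add_mul, mul_assoc, inv_mul_cancel₀ hT.ne']
        linarith
      have h6 := mul_le_mul_of_nonneg_right h5 ht
      linarith
    -- Here the Legendre function stays below `y`, so `M^{*-1}` is already constant beyond `y`; `T →
    -- ∞` removes the error.
    have hl : Tendsto (fun T : ℝ => M t + y + t * z * T⁻¹) atTop (𝓝 (M t + y + t * z * 0)) :=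
      (tendsto_inv_atTop_zero.const_mul _).const_add _
    rw [mul_zero, add_zero] at hl
    exact ge_of_tendsto hl ((eventually_gt_atTop 0).mono key)

/-- The tangent inequalities at `y` and at `z` trap the error between `(z - y) (W z - W y)` and 0,
where `W = M.conjInvDeriv` is continuous. -/
theorem hasDerivAt_conjInv (hM : M.IsRegular) {y : ℝ} (hy : 0 < y) :
    HasDerivAt M.conjInv (M.conjInvDeriv y) y := by
  rw [hasDerivAt_iff_isLittleO, Asymptotics.isLittleO_iff]
  intro c hc
  have hcont := (hM.continuousAt_conjInvDeriv hy).tendsto.sub_const (M.conjInvDeriv y)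
  have hcont' := hcont.norm
  rw [sub_self, norm_zero] at hcont'
  filter_upwards [hcont'.eventually (gt_mem_nhds hc), lt_mem_nhds hy] with z hz hz0
  have h1 := hM.conjInv_le_tangent hy hz0
  have h2 := hM.conjInv_le_tangent hz0 hy
  rw [smul_eq_mul]
  calc ‖M.conjInv z - M.conjInv y - (z - y) * M.conjInvDeriv y‖
      ≤ ‖(z - y) * (M.conjInvDeriv z - M.conjInvDeriv y)‖ := by
        rw [Real.norm_eq_abs, Real.norm_eq_abs]
        refine abs_le_abs_of_nonpos (by linarith) (by linarith)
    _ = ‖M.conjInvDeriv z - M.conjInvDeriv y‖ * ‖z - y‖ := by rw [norm_mul, mul_comm]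
    _ ≤ c * ‖z - y‖ := by gcongr

/-- Below the supremum of the Legendre function, `M.conjInvDeriv` is the reciprocal of its inverse;
above it is 0. The excluded point is that supremum if finite. If it is infinite the set is empty,
its `sInf` is 0, and nothing is excluded. -/
theorem differentiableAt_conjInvDeriv (hM : M.IsRegular) {y : ℝ} (hy : 0 < y)
    (hne : y ≠ sInf {z | 0 < z ∧ M.conjInvDeriv z = 0}) :
    DifferentiableAt ℝ M.conjInvDeriv y := by
  rcases (hM.conjInvDeriv_nonneg hy).eq_or_lt with h0 | hpos
  · have hlt : sInf {z | 0 < z ∧ M.conjInvDeriv z = 0} < y :=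
      lt_of_le_of_ne (csInf_le ⟨0, fun z hz => hz.1.le⟩ ⟨hy, h0.symm⟩) hne.symm
    obtain ⟨z, ⟨hz, hz0⟩, hzy⟩ := exists_lt_of_csInf_lt
      (s := {z | 0 < z ∧ M.conjInvDeriv z = 0}) ⟨y, hy, h0.symm⟩ hlt
    have : M.conjInvDeriv =ᶠ[𝓝 y] fun _ => 0 := by
      filter_upwards [lt_mem_nhds hzy] with x hx
      refine conjInvDeriv_of_forall_lt fun t ht => ?_
      refine lt_trans ((hM.conjInvDeriv_lt_iff hz ht).1 ?_) hx
      rw [hz0]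
      positivity
    exact this.differentiableAt_iff.2 (differentiableAt_const _)
  · have hW := hM.continuousAt_conjInvDeriv hy
    have hinv : ∀ z, 0 < z → 0 < M.conjInvDeriv z → M.legendre (M.conjInvDeriv z)⁻¹ = z :=
      fun z hz hz' => by
        rcases hM.eq_legendre_or hz with ⟨t, ht, rfl⟩ | h
        · rw [hM.conjInvDeriv_legendre ht, inv_inv]
        · exact absurd (conjInvDeriv_of_forall_lt h) hz'.ne'
    have hpi : 0 < (M.conjInvDeriv y)⁻¹ := inv_pos.2 hpos
    have hd : HasDerivAt (fun z => (M.conjInvDeriv z)⁻¹) _ y :=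
      HasDerivAt.of_local_left_inverse (hW.inv₀ hpos.ne') (hM.hasDerivAt_legendre hpi)
        (mul_pos hpi (hM.deriv_deriv_pos _ hpi)).ne' (by
          filter_upwards [hW.eventually (lt_mem_nhds hpos), lt_mem_nhds hy] with z hz hz0
          exact hinv z hz0 hz)
    simpa using hd.differentiableAt.fun_inv hpi.ne'

theorem hasDerivAt_conjInvSq (hM : M.IsRegular) {y : ℝ} (hy : 0 < y) :
    HasDerivAt M.conjInvSq (2 * M.conjInv y * M.conjInvDeriv y) y := by
  have := (hM.hasDerivAt_conjInv hy).pow 2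
  simpa using! this

theorem deriv_conjInvSq (hM : M.IsRegular) {y : ℝ} (hy : 0 < y) :
    deriv M.conjInvSq y = 2 * M.conjInv y * M.conjInvDeriv y :=
  (hM.hasDerivAt_conjInvSq hy).deriv

theorem deriv_conjInvSq_nonneg (hM : M.IsRegular) {y : ℝ} (hy : 0 < y) :
    0 ≤ deriv M.conjInvSq y := by
  rw [hM.deriv_conjInvSq hy]
  have := M.conjInv_nonneg y
  have := hM.conjInvDeriv_nonneg hy
  positivity

theorem deriv_conjInvSq_eventuallyEq (hM : M.IsRegular) {y : ℝ} (hy : 0 < y) :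
    deriv M.conjInvSq =ᶠ[𝓝 y] fun z => 2 * M.conjInv z * M.conjInvDeriv z := by
  filter_upwards [lt_mem_nhds hy] with z hz using hM.deriv_conjInvSq hz

theorem continuousOn_deriv_conjInvSq (hM : M.IsRegular) :
    ContinuousOn (deriv M.conjInvSq) (Ioi 0) := fun _ hy =>
  (((((hM.hasDerivAt_conjInv hy).continuousAt).const_mul 2).mul
    (hM.continuousAt_conjInvDeriv hy)).congr
      (hM.deriv_conjInvSq_eventuallyEq hy).symm).continuousWithinAt

theorem differentiableAt_deriv_conjInvSq (hM : M.IsRegular) {y : ℝ} (hy : 0 < y)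
    (hne : y ≠ sInf {z | 0 < z ∧ M.conjInvDeriv z = 0}) :
    DifferentiableAt ℝ (deriv M.conjInvSq) y :=
  (hM.deriv_conjInvSq_eventuallyEq hy).differentiableAt_iff.2
    (((hM.hasDerivAt_conjInv hy).differentiableAt.const_mul 2).mul
      (hM.differentiableAt_conjInvDeriv hy hne))

/-- At `y = t M'(t) - M t` the intercept equals `(M'(t) / t) (2 M t - t M'(t))`, positive by strict
2-concavity. This keeps the denominator in the density away from 0. -/
theorem conjInvSq_sub_pos (hM : M.IsRegular) {y : ℝ} (hy : 0 < y) :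
    0 < M.conjInvSq y - y * deriv M.conjInvSq y := by
  have hpos : ∀ t, 0 < t → 0 < deriv M t := fun t ht => by
    have h1 := hM.legendre_nonneg ht
    have h2 := M.pos' t ht
    rw [legendre] at h1
    exact (pos_iff_pos_of_mul_pos (by linarith : 0 < t * deriv M t)).1 ht
  rw [hM.deriv_conjInvSq hy, conjInvSq]
  rcases hM.eq_legendre_or hy with ⟨t, ht, rfl⟩ | h
  · have h1 := hM.mul_deriv_lt ht
    rw [hM.conjInvDeriv_legendre ht, hM.conjInv_legendre ht]
    have e : deriv M t ^ 2 - M.legendre t * (2 * deriv M t * t⁻¹)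
        = deriv M t * t⁻¹ * (2 * M t - t * deriv M t) := by
      rw [legendre]
      field_simp
      ring
    rw [e]
    have := hpos t ht
    have : 0 < 2 * M t - t * deriv M t := by linarith
    positivity
  · rw [conjInvDeriv_of_forall_lt h, mul_zero, mul_zero, sub_zero]
    have h1 := M.conjInv_mono (hM.legendre_nonneg one_pos) (h 1 one_pos).le
    rw [hM.conjInv_legendre one_pos] at h1
    have := (hpos 1 one_pos).trans_le h1
    positivity

theorem tendsto_conjInvSq (hM : M.IsRegular) : Tendsto M.conjInvSq (𝓝[>] 0) (𝓝 0) := by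
  have h : Tendsto M.conjInv (𝓝[>] 0) (𝓝 0) := by
    refine tendsto_order.2 ⟨fun w hw => Eventually.of_forall fun y =>
      hw.trans_le (M.conjInv_nonneg y), fun w hw => ?_⟩
    obtain ⟨t, ht, ht'⟩ := ((hM.tendsto_div.eventually (gt_mem_nhds (half_pos hw))).and
      self_mem_nhdsWithin).exists
    have ht0 : 0 < t := ht'
    filter_upwards [self_mem_nhdsWithin, mem_nhdsWithin_of_mem_nhds
      (gt_mem_nhds (mul_pos (half_pos hw) ht0))] with y hy hy'
    have h1 := M.conjInv_mul_le (mem_Ioi.1 hy).le ht0.le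
    rw [div_lt_iff₀ ht0] at ht
    refine lt_of_mul_lt_mul_right (a := t) ?_ ht0.le
    linarith
  simpa using! h.pow 2

end IsRegular

end OrliczFunction

/-! ### The density and its interval means -/

namespace OrliczFunction

/-- `√(H (s) - s H'(s))`. -/
def interceptRoot (M : OrliczFunction) (s : ℝ) : ℝ :=
  √(M.conjInvSq s - s * deriv M.conjInvSq s)

/-- The primitive of the density that vanishes at `0`. -/
def densityPrimitive (M : OrliczFunction) (t : ℝ) : ℝ :=
  t * (√(M.conjInvSq 1) + ∫ s in t..1, M.interceptRoot s / s ^ 2)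

/-- The density, integrated by parts. -/
def densityByParts (M : OrliczFunction) (t : ℝ) : ℝ :=
  √(M.conjInvSq 1) - M.interceptRoot t / t + ∫ s in t..1, M.interceptRoot s / s ^ 2

theorem densityPrimitive_sub (M : OrliczFunction) {t : ℝ} (ht : 0 < t) :
    M.densityPrimitive t - t * M.densityByParts t = M.interceptRoot t := by
  rw [densityPrimitive, densityByParts]
  field_simp
  ring

namespace IsRegular

variable {M : OrliczFunction}

theorem interceptRoot_pos (hM : M.IsRegular) {s : ℝ} (hs : 0 < s) : 0 < M.interceptRoot s :=
  Real.sqrt_pos.2 (hM.conjInvSq_sub_pos hs)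

theorem interceptRoot_sq (hM : M.IsRegular) {s : ℝ} (hs : 0 < s) :
    M.interceptRoot s ^ 2 = M.conjInvSq s - s * deriv M.conjInvSq s :=
  Real.sq_sqrt (hM.conjInvSq_sub_pos hs).le

theorem continuousOn_interceptRoot (hM : M.IsRegular) : ContinuousOn M.interceptRoot (Ioi 0) :=
  (ContinuousOn.sub (fun _ hs => (hM.hasDerivAt_conjInvSq hs).continuousAt.continuousWithinAt)
    (continuousOn_id.mul hM.continuousOn_deriv_conjInvSq)).sqrt

theorem antitoneOn_deriv_conjInvSq (hM : M.IsRegular) :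
    AntitoneOn (deriv M.conjInvSq) (Ioi 0) :=
  ((concaveOn_conjInvSq hM.isTwoConcave).subset Ioi_subset_Ici_self
    (convex_Ioi 0)).antitoneOn_deriv fun _ hs => (hM.hasDerivAt_conjInvSq hs).differentiableAt

/-- Tangents to a concave function meet the vertical axis higher as the point of contact moves
right. -/
theorem interceptRoot_mono (hM : M.IsRegular) {s r : ℝ} (hs : 0 < s) (hsr : s ≤ r) :
    M.interceptRoot s ≤ M.interceptRoot r := by
  have hr := hs.trans_le hsr
  rcases hsr.eq_or_lt with rfl | h
  · rfl
  refine Real.sqrt_le_sqrt ?_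
  have h1 := (concaveOn_conjInvSq hM.isTwoConcave).le_slope_of_hasDerivAt
    (mem_Ici.2 hs.le) (mem_Ici.2 hr.le) h (hM.hasDerivAt_conjInvSq hr)
  rw [← hM.deriv_conjInvSq hr, slope_def_field, le_div_iff₀ (by linarith)] at h1
  have h2 := hM.antitoneOn_deriv_conjInvSq hs hr hsr
  nlinarith

theorem continuousOn_interceptRoot_div (hM : M.IsRegular) :
    ContinuousOn (fun s => M.interceptRoot s / s ^ 2) (Ioi 0) :=
  hM.continuousOn_interceptRoot.div (continuousOn_id.pow 2) fun _ hs => (pow_pos hs 2).ne'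

theorem uIcc_subset_Ioi {a b : ℝ} (ha : 0 < a) (hb : 0 < b) : uIcc a b ⊆ Ioi 0 :=
  fun _ hx => (lt_min ha hb).trans_le hx.1

theorem intervalIntegrable_interceptRoot_div (hM : M.IsRegular) {a b : ℝ} (ha : 0 < a)
    (hb : 0 < b) : IntervalIntegrable (fun s => M.interceptRoot s / s ^ 2) volume a b :=
  (hM.continuousOn_interceptRoot_div.mono (uIcc_subset_Ioi ha hb)).intervalIntegrable

theorem hasDerivAt_integral_interceptRoot (hM : M.IsRegular) {t : ℝ} (ht : 0 < t) :
    HasDerivAt (fun t => ∫ s in t..1, M.interceptRoot s / s ^ 2)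
      (-(M.interceptRoot t / t ^ 2)) t :=
  intervalIntegral.integral_hasDerivAt_left
    (hM.intervalIntegrable_interceptRoot_div ht one_pos)
    (hM.continuousOn_interceptRoot_div.stronglyMeasurableAtFilter isOpen_Ioi t ht)
    (hM.continuousOn_interceptRoot_div.continuousAt (Ioi_mem_nhds ht))

theorem hasDerivAt_densityPrimitive (hM : M.IsRegular) {t : ℝ} (ht : 0 < t) :
    HasDerivAt M.densityPrimitive (M.densityByParts t) t := by
  have h := (hasDerivAt_id t).mul
    ((hM.hasDerivAt_integral_interceptRoot ht).const_add (√(M.conjInvSq 1)))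
  refine h.congr_deriv ?_
  simp only [id, densityByParts]
  field_simp
  ring

theorem continuousOn_densityByParts (hM : M.IsRegular) :
    ContinuousOn M.densityByParts (Ioi 0) :=
  (continuousOn_const.sub (hM.continuousOn_interceptRoot.div continuousOn_id
    fun _ hs => (mem_Ioi.1 hs).ne')).add fun _ hs =>
      (hM.hasDerivAt_integral_interceptRoot hs).continuousAt.continuousWithinAt

theorem densityByParts_anti (hM : M.IsRegular) {t r : ℝ} (ht : 0 < t) (htr : t ≤ r) :
    M.densityByParts r ≤ M.densityByParts t := by
  have hr := ht.trans_le htr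
  have h1 := intervalIntegral.integral_add_adjacent_intervals
    (hM.intervalIntegrable_interceptRoot_div ht hr)
    (hM.intervalIntegrable_interceptRoot_div hr one_pos)
  have hcont : ContinuousOn (fun s : ℝ => M.interceptRoot t / s ^ 2) (uIcc t r) :=
    continuousOn_const.div (continuousOn_id.pow 2)
      fun s hs => (pow_pos (uIcc_subset_Ioi ht hr hs) 2).ne'
  have h2 : ∫ s in t..r, M.interceptRoot t / s ^ 2
      = -M.interceptRoot t / r - -M.interceptRoot t / t := by
    refine intervalIntegral.integral_eq_sub_of_hasDerivAt (f := fun s => -M.interceptRoot t / s)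
      (fun s hs => ?_) hcont.intervalIntegrable
    have hs0 : s ≠ 0 := (mem_Ioi.1 (uIcc_subset_Ioi ht hr hs)).ne'
    have := (hasDerivAt_inv hs0).const_mul (-M.interceptRoot t)
    refine this.congr_deriv ?_
    field_simp
  have h3 : ∫ s in t..r, M.interceptRoot t / s ^ 2 ≤ ∫ s in t..r, M.interceptRoot s / s ^ 2 :=
    intervalIntegral.integral_mono_on htr hcont.intervalIntegrable
      (hM.intervalIntegrable_interceptRoot_div ht hr) fun s hs =>
        div_le_div_of_nonneg_right (hM.interceptRoot_mono ht hs.1) (sq_nonneg s)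
  have h4 : M.interceptRoot t / r ≤ M.interceptRoot r / r :=
    div_le_div_of_nonneg_right (hM.interceptRoot_mono ht htr) hr.le
  rw [densityByParts, densityByParts]
  rw [h2, neg_div, neg_div] at h3
  linarith

theorem densityByParts_nonneg (hM : M.IsRegular) {t : ℝ} (ht : 0 < t) (ht1 : t ≤ 1) :
    0 ≤ M.densityByParts t := by
  refine le_trans ?_ (hM.densityByParts_anti ht ht1)
  have : M.interceptRoot 1 ≤ √(M.conjInvSq 1) :=
    Real.sqrt_le_sqrt (by linarith [hM.deriv_conjInvSq_nonneg one_pos])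
  rw [densityByParts, intervalIntegral.integral_same]
  linarith

/-- Since `(F - t f)² = H - t H'`, the quotient `(F² - H) / t` has derivative `f²`, and it vanishes
at 1 because `F 1 = √(H 1)`. -/
theorem conjInvSq_eq (hM : M.IsRegular) {t : ℝ} (ht : 0 < t) :
    M.conjInvSq t = M.densityPrimitive t ^ 2 + t * ∫ s in t..1, M.densityByParts s ^ 2 := by
  have hd : ∀ s ∈ uIcc t 1, HasDerivAt
      (fun s => (M.densityPrimitive s ^ 2 - M.conjInvSq s) / s) (M.densityByParts s ^ 2) s :=
    fun s hs => by
      have hs0 : 0 < s := uIcc_subset_Ioi ht one_pos hs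
      have hH := (hM.hasDerivAt_conjInvSq hs0).differentiableAt.hasDerivAt
      have h := (((hM.hasDerivAt_densityPrimitive hs0).pow 2).sub hH).div (hasDerivAt_id s) hs0.ne'
      refine h.congr_deriv ?_
      have h1 := M.densityPrimitive_sub hs0
      have h2 := hM.interceptRoot_sq hs0
      rw [← h1] at h2
      simp only [id, Pi.pow_apply, Pi.sub_apply]
      rw [div_eq_iff (by positivity)]
      linear_combination -h2
  have hint : IntervalIntegrable (fun s => M.densityByParts s ^ 2) volume t 1 :=
    ((hM.continuousOn_densityByParts.pow 2).mono (uIcc_subset_Ioi ht one_pos)).intervalIntegrable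
  rw [intervalIntegral.integral_eq_sub_of_hasDerivAt hd hint]
  have h1 : M.densityPrimitive 1 ^ 2 = M.conjInvSq 1 := by
    rw [densityPrimitive, intervalIntegral.integral_same, add_zero, one_mul,
      Real.sq_sqrt (M.conjInvSq_nonneg 1)]
  rw [h1]
  field_simp
  ring

theorem continuousOn_densityPrimitive (hM : M.IsRegular) :
    ContinuousOn M.densityPrimitive (Icc 0 1) := by
  intro t ht
  rcases ht.1.eq_or_lt with rfl | h0
  · have hz : M.densityPrimitive 0 = 0 := by simp [densityPrimitive]
    rw [← Ioc_insert_left zero_le_one, continuousWithinAt_insert_self, ContinuousWithinAt, hz]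
    have hs : Tendsto (fun t => √(M.conjInvSq t)) (𝓝[Ioc 0 1] 0) (𝓝 0) := by
      have := (hM.tendsto_conjInvSq.sqrt).mono_left
        (nhdsWithin_mono 0 (Ioc_subset_Ioi_self : Ioc (0 : ℝ) 1 ⊆ Ioi 0))
      rwa [Real.sqrt_zero] at this
    -- `conjInvSq_eq` gives `F² ≤ H`, and `H` tends to 0 because `M t / t` does.
    refine squeeze_zero_norm' ?_ hs
    filter_upwards [self_mem_nhdsWithin] with t ht
    rw [Real.norm_eq_abs]
    refine Real.abs_le_sqrt ?_
    rw [hM.conjInvSq_eq ht.1]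
    have : 0 ≤ ∫ s in t..1, M.densityByParts s ^ 2 :=
      intervalIntegral.integral_nonneg ht.2 fun s _ => sq_nonneg _
    have := mul_nonneg ht.1.le this
    linarith
  · exact (hM.hasDerivAt_densityPrimitive h0).continuousAt.continuousWithinAt

theorem density_eq (hM : M.IsRegular) {t : ℝ} (ht : 0 < t) (ht1 : t ≤ 1) :
    M.density t = M.densityByParts t := by
  set H' := deriv M.conjInvSq with hH'
  have hsub : uIcc t 1 ⊆ Ioi 0 := uIcc_subset_Ioi ht one_pos
  have hint2 : IntervalIntegrable (deriv H') volume t 1 := by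
    have h1 : MonotoneOn (fun s => -H' s) (uIcc t 1) :=
      (hM.antitoneOn_deriv_conjInvSq.mono hsub).neg
    have h2 := h1.intervalIntegrable_deriv.neg
    refine h2.congr fun s _ => ?_
    simp
  have hint : IntervalIntegrable (fun s => deriv H' s / M.interceptRoot s) volume t 1 := by
    have : ContinuousOn (fun s => (M.interceptRoot s)⁻¹) (uIcc t 1) :=
      (hM.continuousOn_interceptRoot.mono hsub).inv₀
        fun s hs => (hM.interceptRoot_pos (hsub hs)).ne'
    simpa only [div_eq_mul_inv] using hint2.mul_continuousOn this
  -- The integrand is the derivative of `g s / s` with `g = M.interceptRoot`, as `g' = -s H'' / (2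
  -- g)`. It may fail to exist at the single point where `M^{*-1}` becomes constant, which
  -- continuity of `g` makes harmless.
  have hparts : ∫ s in t..1, (-(1 / 2) * (deriv H' s / M.interceptRoot s)
      - M.interceptRoot s / s ^ 2) = M.interceptRoot 1 / 1 - M.interceptRoot t / t := by
    refine integral_eq_of_hasDerivAt_off_countable_of_le (fun s => M.interceptRoot s / s) _ ht1
      (s := {sInf {z | 0 < z ∧ M.conjInvDeriv z = 0}}) (countable_singleton _) ?_ ?_ ?_
    · rw [← uIcc_of_le ht1]
      exact ((hM.continuousOn_interceptRoot.div continuousOn_id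
        fun _ hs => (mem_Ioi.1 hs).ne').mono hsub)
    · intro s hs
      have hs0 : 0 < s := ht.trans hs.1.1
      have hg := hM.interceptRoot_pos hs0
      have h1 := (hM.differentiableAt_deriv_conjInvSq hs0 hs.2).hasDerivAt
      have h2 := (hM.hasDerivAt_conjInvSq hs0).differentiableAt.hasDerivAt
      have h3 : HasDerivAt M.interceptRoot ((deriv M.conjInvSq s - (1 * deriv M.conjInvSq s
          + s * deriv (deriv M.conjInvSq) s)) / (2 * M.interceptRoot s)) s := (h2.sub ((hasDerivAt_id s).mul h1)).sqrt (hM.conjInvSq_sub_pos hs0).ne'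
      have h4 := h3.div (hasDerivAt_id s) hs0.ne'
      refine h4.congr_deriv ?_
      simp only [id, ← hH']
      field_simp
      ring
    · exact (hint.const_mul _).sub (hM.intervalIntegrable_interceptRoot_div ht one_pos)
  rw [intervalIntegral.integral_sub (hint.const_mul _)
    (hM.intervalIntegrable_interceptRoot_div ht one_pos),
    intervalIntegral.integral_const_mul] at hparts
  have e1 : M.density t = -(1 / 2) * (∫ s in t..1, deriv H' s / M.interceptRoot s)
      + √(M.conjInvSq 1) - M.interceptRoot 1 := by
    simp only [density, interceptRoot, hH', one_mul]
  rw [e1, densityByParts]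
  linarith

theorem integral_density (hM : M.IsRegular) {a b : ℝ} (ha : 0 ≤ a) (hab : a ≤ b) (hb : b ≤ 1) :
    ∫ t in a..b, M.density t = M.densityPrimitive b - M.densityPrimitive a := by
  have hcont : ContinuousOn M.densityPrimitive (Icc a b) :=
    hM.continuousOn_densityPrimitive.mono (Icc_subset_Icc ha hb)
  have hd : ∀ t ∈ Ioo a b, HasDerivAt M.densityPrimitive (M.densityByParts t) t :=
    fun t ht => hM.hasDerivAt_densityPrimitive (ha.trans_lt ht.1)
  rw [← intervalIntegral.integral_eq_sub_of_hasDerivAt_of_le hab hcont hd]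
  · refine intervalIntegral.integral_congr_Ioo_of_le hab fun t ht => ?_
    exact hM.density_eq (ha.trans_lt ht.1) (ht.2.le.trans hb)
  · refine intervalIntegral.intervalIntegrable_deriv_of_nonneg (g := M.densityPrimitive)
      (by rwa [uIcc_of_le hab]) ?_ ?_ <;> rw [min_eq_left hab, max_eq_right hab]
    · exact hd
    · exact fun t ht => hM.densityByParts_nonneg (ha.trans_lt ht.1) (ht.2.le.trans hb)

/-- The means of the density over the intervals `[j/n, (j+1)/n]` represent `M`. -/
theorem represents (hM : M.IsRegular) {n : ℕ} (hn : 1 ≤ n) :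
    M.Represents n fun j => n * ∫ t in (j : ℝ) / n..((j : ℝ) + 1) / n, M.density t := by
  have hn0 : (0 : ℝ) < n := by exact_mod_cast hn
  set F := M.densityPrimitive with hF
  set f := M.densityByParts with hf
  set α : ℕ → ℝ := fun j => n * ∫ t in (j : ℝ) / n..((j : ℝ) + 1) / n, M.density t with hα
  have hlt : ∀ j : ℕ, (j : ℝ) / n < ((j : ℝ) + 1) / n := fun j => by
    gcongr
    exact lt_add_one _
  have h0j : ∀ j : ℕ, (0 : ℝ) ≤ (j : ℝ) / n := fun j => by positivity
  have hj1 : ∀ j < n, ((j : ℝ) + 1) / n ≤ 1 := fun j hj => by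
    rw [div_le_one hn0]
    exact_mod_cast hj
  have hαF : ∀ j < n, α j = n * (F (((j : ℝ) + 1) / n) - F ((j : ℝ) / n)) := fun j hj => by
    simp only [hα]
    rw [hM.integral_density (h0j j) (hlt j).le (hj1 j hj)]
  -- As means of `f` that are values of `f`, the `α j` inherit sign and monotonicity from it.
  have hξ : ∀ j < n, ∃ ξ, (j : ℝ) / n < ξ ∧ ξ < ((j : ℝ) + 1) / n ∧ α j = f ξ := fun j hj => by
    obtain ⟨ξ, hξ, e⟩ := exists_hasDerivAt_eq_slope F f (hlt j)
      (hM.continuousOn_densityPrimitive.mono (Icc_subset_Icc (h0j j) (hj1 j hj)))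
      fun t ht => hM.hasDerivAt_densityPrimitive ((h0j j).trans_lt ht.1)
    refine ⟨ξ, hξ.1, hξ.2, ?_⟩
    rw [e, hαF j hj]
    field_simp
    ring
  have hstep : ∀ j k : ℕ, j < k → ((j : ℝ) + 1) / n ≤ (k : ℝ) / n := fun j k hjk => by
    gcongr
    exact_mod_cast hjk
  have hnn : ∀ j < n, 0 ≤ α j := fun j hj => by
    obtain ⟨ξ, h1, h2, e⟩ := hξ j hj
    rw [e]
    exact hM.densityByParts_nonneg ((h0j j).trans_lt h1) (h2.le.trans (hj1 j hj))
  have hanti : ∀ j k, j ≤ k → k < n → α k ≤ α j := fun j k hjk hk => by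
    rcases hjk.eq_or_lt with rfl | h
    · rfl
    obtain ⟨ξ, h1, h2, e⟩ := hξ j (h.trans hk)
    obtain ⟨ζ, h3, h4, e'⟩ := hξ k hk
    rw [e, e']
    exact hM.densityByParts_anti ((h0j j).trans_lt h1) (h2.le.trans ((hstep j k h).trans h3.le))
  have hsum : ∀ k ≤ n, (∑ j ∈ Finset.range k, α j) / n = F (k / n) := fun k hk => by
    have h1 : ∑ j ∈ Finset.range k, α j = n * F (k / n) := by
      rw [Finset.sum_congr rfl fun j hj => hαF j ((Finset.mem_range.1 hj).trans_le hk),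
        ← Finset.mul_sum]
      have := Finset.sum_range_sub (fun j : ℕ => F ((j : ℝ) / n)) k
      push_cast at this
      rw [this]
      simp [hF, densityPrimitive]
    rw [h1, mul_div_cancel_left₀ _ hn0.ne']
  have hint : ∀ j : ℕ, 1 ≤ j → ∀ g : ℝ → ℝ, ContinuousOn g (Ioi 0) →
      IntervalIntegrable g volume ((j : ℝ) / n) (((j : ℝ) + 1) / n) := fun j hj g hg =>
    (hg.mono (uIcc_subset_Ioi (by positivity) (by positivity))).intervalIntegrable
  have hf2 : ContinuousOn (fun t => f t ^ 2) (Ioi 0) := hM.continuousOn_densityByParts.pow 2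
  -- Jensen's inequality, from `f² ≥ 2 (α j) f - (α j)²`. The interval with `j = 0` is left out
  -- because `f` may be unbounded at 0.
  have hIlow : ∀ j, 1 ≤ j → j < n →
      α j ^ 2 / n ≤ ∫ t in (j : ℝ) / n..((j : ℝ) + 1) / n, f t ^ 2 := fun j hj hjn => by
    have h1 : ∫ t in (j : ℝ) / n..((j : ℝ) + 1) / n, (2 * α j * f t - α j ^ 2)
        ≤ ∫ t in (j : ℝ) / n..((j : ℝ) + 1) / n, f t ^ 2 := by
      refine intervalIntegral.integral_mono_on (hlt j).le (hint j hj _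
        ((continuousOn_const.mul hM.continuousOn_densityByParts).sub continuousOn_const))
        (hint j hj _ hf2) fun t _ => ?_
      nlinarith [sq_nonneg (f t - α j)]
    have h2 : ∫ t in (j : ℝ) / n..((j : ℝ) + 1) / n, f t = α j / n := by
      rw [intervalIntegral.integral_eq_sub_of_hasDerivAt (f := F) (fun t ht =>
        hM.hasDerivAt_densityPrimitive (uIcc_subset_Ioi (by positivity) (by positivity) ht))
        (hint j hj _ hM.continuousOn_densityByParts), hαF j hjn]
      field_simp
    rw [intervalIntegral.integral_sub ((hint j hj _ hM.continuousOn_densityByParts).const_mul _)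
      (hint j hj _ continuousOn_const), intervalIntegral.integral_const_mul, h2,
      intervalIntegral.integral_const, smul_eq_mul] at h1
    refine le_trans (le_of_eq ?_) h1
    field_simp
    ring
  have hIup : ∀ j, 1 ≤ j → j < n →
      ∫ t in (j : ℝ) / n..((j : ℝ) + 1) / n, f t ^ 2 ≤ α (j - 1) ^ 2 / n := fun j hj hjn => by
    have h1 : ∫ t in (j : ℝ) / n..((j : ℝ) + 1) / n, f t ^ 2
        ≤ ∫ t in (j : ℝ) / n..((j : ℝ) + 1) / n, α (j - 1) ^ 2 := by
      refine intervalIntegral.integral_mono_on (hlt j).le (hint j hj _ hf2)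
        (hint j hj _ continuousOn_const) fun t ht => ?_
      obtain ⟨ξ, h1, h2, e⟩ := hξ (j - 1) (by omega)
      have ht0 : 0 < t := lt_of_lt_of_le (by positivity) ht.1
      rw [e]
      exact pow_le_pow_left₀ (hM.densityByParts_nonneg ht0 (ht.2.trans (hj1 j hjn)))
        (hM.densityByParts_anti ((h0j _).trans_lt h1)
          (h2.le.trans ((hstep (j - 1) j (by omega)).trans ht.1))) 2
    rw [intervalIntegral.integral_const, smul_eq_mul] at h1
    refine h1.trans (le_of_eq ?_)
    field_simp
    ring
  have hR : ∀ k, 1 ≤ k → k ≤ n → ∫ t in (k : ℝ) / n..1, f t ^ 2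
      = ∑ j ∈ Finset.Ico k n, ∫ t in (j : ℝ) / n..((j : ℝ) + 1) / n, f t ^ 2 :=
    fun k hk hkn => by
      have := intervalIntegral.sum_integral_adjacent_intervals_Ico (μ := volume)
        (f := fun t => f t ^ 2) (a := fun j : ℕ => (j : ℝ) / n) hkn fun j hj => by
          have := hint j (hk.trans hj.1) _ hf2
          simpa using this
      push_cast at this
      rw [this, div_self hn0.ne']
  refine ⟨hnn, hanti, fun k hk hkn => ?_, fun k hk hkn => ?_⟩
  · have hk0 : (0 : ℝ) < (k : ℝ) / n := by positivity
    rw [hM.conjInvSq_eq hk0, hsum k hkn, hR k hk hkn, Finset.sum_div]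
    gcongr with j hj
    exact hIlow j (hk.trans (Finset.mem_Ico.1 hj).1) (Finset.mem_Ico.1 hj).2
  · have hk0 : (0 : ℝ) < (k : ℝ) / n := by positivity
    have hk' : (1 : ℝ) ≤ k := by exact_mod_cast hk
    -- Bounding `f` on each interval by the previous mean shifts the sum by one index. The extra
    -- term `α (k - 1) ^ 2 / n` is absorbed by the squared partial sum, since `k α (k - 1)` is at
    -- most the sum of the first `k` terms; hence the factor 2 in `Represents`.
    have h1 : ∫ t in (k : ℝ) / n..1, f t ^ 2
        ≤ α (k - 1) ^ 2 / n + (∑ j ∈ Finset.Ico k n, α j ^ 2) / n := by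
      rw [hR k hk hkn]
      calc ∑ j ∈ Finset.Ico k n, ∫ t in (j : ℝ) / n..((j : ℝ) + 1) / n, f t ^ 2
          ≤ ∑ j ∈ Finset.Ico k n, α (j - 1) ^ 2 / n := Finset.sum_le_sum fun j hj =>
            hIup j (hk.trans (Finset.mem_Ico.1 hj).1) (Finset.mem_Ico.1 hj).2
        _ = ∑ j ∈ Finset.Ico (k - 1) (n - 1), α j ^ 2 / n := by
            obtain ⟨k, rfl⟩ : ∃ l, k = l + 1 := ⟨k - 1, by omega⟩
            obtain ⟨n, rfl⟩ : ∃ l, n = l + 1 := ⟨n - 1, by omega⟩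
            rw [← Finset.sum_Ico_add' (fun j => α (j - 1) ^ 2 / ((n + 1 : ℕ) : ℝ)) k n 1]
            simp
        _ ≤ ∑ j ∈ Finset.Ico (k - 1) n, α j ^ 2 / n :=
            Finset.sum_le_sum_of_subset_of_nonneg
              (Finset.Ico_subset_Ico_right (Nat.sub_le n 1)) fun _ _ _ => by positivity
        _ = α (k - 1) ^ 2 / n + (∑ j ∈ Finset.Ico k n, α j ^ 2) / n := by
            rw [Finset.sum_eq_sum_Ico_succ_bot (by omega : k - 1 < n), Nat.sub_add_cancel hk,
              Finset.sum_div]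
    have h2 : k * α (k - 1) ≤ ∑ j ∈ Finset.range k, α j := by
      have := Finset.card_nsmul_le_sum (Finset.range k) α (α (k - 1)) fun i hi =>
        hanti i (k - 1) (by have := Finset.mem_range.1 hi; omega) (by omega)
      simpa using this
    have h3 : (k : ℝ) / n * (α (k - 1) ^ 2 / n) ≤ ((∑ j ∈ Finset.range k, α j) / n) ^ 2 := by
      have h4 := hnn (k - 1) (by omega)
      calc (k : ℝ) / n * (α (k - 1) ^ 2 / n) = k * α (k - 1) ^ 2 / n ^ 2 := by
            field_simp
        _ ≤ (k * α (k - 1)) ^ 2 / n ^ 2 := by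
            refine div_le_div_of_nonneg_right ?_ (sq_nonneg _)
            rw [mul_pow (k : ℝ) (α (k - 1)) 2]
            exact mul_le_mul_of_nonneg_right (le_self_pow₀ hk' two_ne_zero) (sq_nonneg _)
        _ ≤ (∑ j ∈ Finset.range k, α j) ^ 2 / n ^ 2 := by gcongr
        _ = _ := (div_pow _ _ _).symm
    have h5 : 0 ≤ (k : ℝ) / n * ((∑ j ∈ Finset.Ico k n, α j ^ 2) / n) := by positivity
    have h6 := mul_le_mul_of_nonneg_left h1 hk0.le
    rw [mul_add] at h6
    rw [hM.conjInvSq_eq hk0, ← hf, ← hF, ← hsum k hkn]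
    linarith

end IsRegular

end OrliczFunction

/-! ### The mean over signs and permutations against the Luxemburg norm -/

section SignPermMap

open scoped BigOperators

variable {n : ℕ} (M : Fin n → OrliczFunction)

/-- The map `x ↦ (∑ᵢ xᵢ εᵢ a_{i,π(i)})_{ε,π}` of a matrix `a`. -/
def signPermMap (a : Fin n → Fin n → ℝ) :
    MusielakOrliczSpace M →ₗ[ℝ] AvgL1 (SignPerm n) where
  toFun x := fun p : SignPerm n => signSum (fun i => x i * a i (p.2 i)) p.1
  map_add' x y := by
    funext p
    change ∑ i, (x i + y i) * _ * _ = ∑ i, _ + ∑ i, _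
    rw [← Finset.sum_add_distrib]
    exact Finset.sum_congr rfl fun i _ => by ring
  map_smul' c x := by
    funext p
    change ∑ i, (c * x i) * _ * _ = c * ∑ i, _
    rw [Finset.mul_sum]
    exact Finset.sum_congr rfl fun i _ => by ring

theorem embedding_eq_signPermMap : embedding M = signPermMap M (embeddingMatrix M) := by
  ext x
  funext p
  change ∑ i : Fin n, _ = ∑ i : Fin n, _
  exact Finset.sum_congr rfl fun i _ => mul_right_comm _ _ _

/-- The mean of `|∑ᵢ xᵢ εᵢ a_{i,π(i)}|` over all `(ε, π)`. -/
def signPermMean (a : Fin n → Fin n → ℝ) (x : Fin n → ℝ) : ℝ :=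
  𝔼 π : Equiv.Perm (Fin n), 𝔼 ε, |signSum (fun i => x i * a i (π i)) ε|

theorem signPermMean_eq (a : Fin n → Fin n → ℝ) (x : Fin n → ℝ) : signPermMean a x
    = 1 / (Fintype.card (SignPerm n) : ℝ)
      * ∑ p : SignPerm n, |signSum (fun i => x i * a i (p.2 i)) p.1| := by
  rw [signPermMean, Finset.expect_comm, ← Finset.expect_product', Finset.univ_product_univ,
    Fintype.expect_eq_sum_div_card, one_div_mul_eq_div]

theorem norm_signPermMap (a : Fin n → Fin n → ℝ) (x : MusielakOrliczSpace M) :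
    ‖signPermMap M a x‖ = signPermMean a x :=
  (signPermMean_eq a x).symm

theorem signPermMean_nonneg (a : Fin n → Fin n → ℝ) (x : Fin n → ℝ) : 0 ≤ signPermMean a x :=
  Finset.expect_nonneg fun _ _ => Finset.expect_nonneg fun _ _ => abs_nonneg _

theorem signPermMean_smul (a : Fin n → Fin n → ℝ) {c : ℝ} (hc : 0 ≤ c) (x : Fin n → ℝ) :
    signPermMean a (c • x) = c * signPermMean a x := by
  simp only [signPermMean, Finset.mul_expect, signSum]
  refine Finset.expect_congr rfl fun π _ => Finset.expect_congr rfl fun ε _ => ?_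
  rw [← abs_of_nonneg hc, ← abs_mul, Finset.mul_sum, abs_of_nonneg hc]
  refine congrArg _ (Finset.sum_congr rfl fun i _ => ?_)
  rw [Pi.smul_apply, smul_eq_mul]
  ring

variable {M} {α : Fin n → ℕ → ℝ}

theorem modular_eq_sum_rowModular (α : Fin n → ℕ → ℝ) (x : Fin n → ℝ) :
    modular (fun i j => |x i| * α i j) = ∑ i, OrliczFunction.rowModular n (α i) |x i| := by
  refine Finset.sum_congr rfl fun i _ => ?_
  rw [Fintype.expect_eq_sum_div_card, Fintype.card_fin, OrliczFunction.rowModular,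
    Fin.sum_univ_eq_sum_range fun j => min (|x i| * α i j) ((|x i| * α i j) ^ 2)]

theorem signPermMean_le_modular (hα : ∀ i, (M i).Represents n (α i))
    (x : Fin n → ℝ) :
    signPermMean (fun i j => α i j) x ≤ modular (fun i j => |x i| * α i j) + 1 / 2 := by
  refine le_trans ?_ (expect_perm_sqrt_le fun i j =>
    mul_nonneg (abs_nonneg _) ((hα i).nonneg j j.2))
  refine Finset.expect_le_expect fun π _ => (expect_abs_signSum_le _).trans_eq ?_
  simp only [mul_pow, sq_abs]

theorem modular_le_signPermMean (hα : ∀ i, (M i).Represents n (α i))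
    (x : Fin n → ℝ) :
    modular (fun i j => |x i| * α i j) / √(1 + 2 * modular (fun i j => |x i| * α i j)) / √3
      ≤ signPermMean (fun i j => α i j) x := by
  refine (div_le_div_of_nonneg_right (le_expect_perm_sqrt fun i j =>
    mul_nonneg (abs_nonneg _) ((hα i).nonneg j j.2)) (Real.sqrt_nonneg 3)).trans ?_
  rw [signPermMean, Finset.expect_div]
  refine Finset.expect_le_expect fun π _ => le_trans (le_of_eq ?_) (sqrt_le_expect_abs_signSum _)
  simp only [mul_pow, sq_abs]

theorem sum_inv_le_one (n : ℕ) : ∑ _i : Fin n, 1 / (n : ℝ) ≤ 1 := by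
  rcases Nat.eq_zero_or_pos n with rfl | hn
  · simp
  · have : (n : ℝ) ≠ 0 := by positivity
    simp [this]

theorem signPermMean_le_luxNorm (hα : ∀ i, (M i).Represents n (α i)) (x : Fin n → ℝ) :
    signPermMean (fun i j => α i j) x ≤ 10 * MusielakOrliczSpace.luxNorm M x := by
  set Ψ := signPermMean (fun i j : Fin n => α i j) with hΨ
  -- At `x / 4` the modular is at most `1 + n (1/n) = 2`, so the mean is at most `5/2`; scaling back
  -- gives 10.
  have key : ∀ x : Fin n → ℝ, ∑ i, M i |x i| ≤ 1 → Ψ x ≤ 10 := fun x hx => by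
    have h1 := signPermMean_le_modular hα ((1 / 4 : ℝ) • x)
    have h2 : modular (fun i j => |((1 / 4 : ℝ) • x) i| * α i j) ≤ 2 := by
      rw [modular_eq_sum_rowModular]
      calc ∑ i, OrliczFunction.rowModular n (α i) |((1 / 4 : ℝ) • x) i|
          ≤ ∑ i, (M i |x i| + 1 / n) := by
            refine Finset.sum_le_sum fun i _ => ?_
            have e : |((1 / 4 : ℝ) • x) i| = |x i| / 4 := by
              rw [Pi.smul_apply, smul_eq_mul, abs_mul, abs_of_pos (by norm_num)]
              ring
            rw [e]
            refine OrliczFunction.rowModular_div_four_le (hα i) i.pos (abs_nonneg _) ?_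
            exact (Finset.single_le_sum (f := fun i => M i |x i|)
              (fun j _ => (M j).nonneg (abs_nonneg _)) (Finset.mem_univ i)).trans hx
        _ ≤ 2 := by
            rw [Finset.sum_add_distrib]
            linarith [sum_inv_le_one n]
    rw [signPermMean_smul _ (by norm_num), ← hΨ] at h1
    linarith
  refine le_of_forall_gt_imp_ge_of_dense fun c hc => ?_
  have hc' : MusielakOrliczSpace.luxNorm M x < c / 10 := by linarith
  obtain ⟨hρ, hadm⟩ := MusielakOrliczSpace.admissible_of_lt M hc'
  have h := key ((c / 10)⁻¹ • x) (by
    refine le_trans (le_of_eq (Finset.sum_congr rfl fun i _ => ?_)) hadm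
    rw [Pi.smul_apply, smul_eq_mul, abs_mul, abs_of_pos (inv_pos.2 hρ), inv_mul_eq_div])
  rw [hΨ, signPermMean_smul _ (inv_pos.2 hρ).le, inv_mul_le_iff₀ hρ] at h
  linarith

theorem luxNorm_le_signPermMean (hα : ∀ i, (M i).Represents n (α i)) (x : Fin n → ℝ) :
    MusielakOrliczSpace.luxNorm M x ≤ 24 * signPermMean (fun i j => α i j) x := by
  set Ψ := signPermMean (fun i j : Fin n => α i j) with hΨ
  -- A modular `A > 1` would force the mean to be at least `1/3`, because `√(1 + 2 A) ≤ √3 A`. With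
  -- `A ≤ 1` the values `M i (|x i| / 4)` add up to at most 2, and convexity halves this at `|x i| /
  -- 8`. The constant 24 is `8 · 3`.
  have key : ∀ x : Fin n → ℝ, Ψ x < 1 / 3 → MusielakOrliczSpace.luxNorm M x ≤ 8 := fun x hx => by
    have h1 := modular_le_signPermMean hα x
    have hA : modular (fun i j => |x i| * α i j) ≤ 1 := by
      by_contra! hA
      set A := modular (fun i j => |x i| * α i j)
      have h2 : √(1 + 2 * A) ≤ √3 * A := by
        rw [Real.sqrt_le_iff, mul_pow, Real.sq_sqrt (by norm_num)]
        exact ⟨by positivity, by nlinarith⟩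
      have h3 : 1 / 3 ≤ A / √(1 + 2 * A) / √3 := by
        have h0 : 0 < √(1 + 2 * A) := Real.sqrt_pos.2 (by linarith)
        rw [div_div, div_le_div_iff₀ (by norm_num) (by positivity), one_mul]
        calc √(1 + 2 * A) * √3 ≤ √3 * A * √3 := by gcongr
          _ = A * (√3 * √3) := by ring
          _ = A * 3 := by rw [Real.mul_self_sqrt (by norm_num)]
      linarith
    rw [modular_eq_sum_rowModular] at hA
    refine MusielakOrliczSpace.luxNorm_le M (by norm_num) ?_
    have h4 : ∀ i, M i (|x i| / 8)
        ≤ 1 / 2 * (OrliczFunction.rowModular n (α i) |x i| + 1 / n) := fun i => by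
      have h5 := OrliczFunction.map_div_four_le (hα i) i.pos (abs_nonneg (x i))
        ((Finset.single_le_sum (f := fun i => OrliczFunction.rowModular n (α i) |x i|)
          (fun j _ => OrliczFunction.rowModular_nonneg (hα j) (abs_nonneg _))
          (Finset.mem_univ i)).trans hA)
      have h6 := (M i).map_mul_le (r := 1 / 2) (t := |x i| / 4) (by norm_num) (by norm_num)
        (by positivity)
      rw [show 1 / 2 * (|x i| / 4) = |x i| / 8 by ring] at h6
      linarith
    refine (Finset.sum_le_sum fun i _ => h4 i).trans ?_
    rw [← Finset.mul_sum, Finset.sum_add_distrib]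
    linarith [sum_inv_le_one n]
  refine le_of_forall_gt_imp_ge_of_dense fun c hc => ?_
  have hc0 : 0 < c / 8 := by linarith [signPermMean_nonneg (fun i j => α i j) x]
  have h := key ((c / 8)⁻¹ • x) (by
    rw [hΨ, signPermMean_smul _ (inv_pos.2 hc0).le, inv_mul_lt_iff₀ hc0]
    linarith)
  have h' := MusielakOrliczSpace.luxNorm_smul_le M (c / 8) ((c / 8)⁻¹ • x)
  rw [smul_inv_smul₀ hc0.ne', abs_of_pos hc0] at h'
  nlinarith

end SignPermMap

/-! ### Banach–Mazur distance to a range, and step functions in `L_1[0, 1]` -/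

section Spaces

instance {n : ℕ} (M : Fin n → OrliczFunction) : FiniteDimensional ℝ (MusielakOrliczSpace M) :=
  inferInstanceAs (FiniteDimensional ℝ (Fin n → ℝ))

theorem finrank_musielakOrliczSpace {n : ℕ} (M : Fin n → OrliczFunction) :
    Module.finrank ℝ (MusielakOrliczSpace M) = n :=
  Module.finrank_fin_fun ℝ

theorem injective_of_norm_le {X Y : Type} [NormedAddCommGroup X] [NormedSpace ℝ X]
    [NormedAddCommGroup Y] [NormedSpace ℝ Y] {Ψ : X →ₗ[ℝ] Y} {c : ℝ}
    (h : ∀ x, ‖x‖ ≤ c * ‖Ψ x‖) : Function.Injective Ψ :=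
  (injective_iff_map_eq_zero Ψ).2 fun x hx => norm_le_zero_iff.1 (by simpa [hx] using h x)

theorem banachMazurDist_range_le {X Y : Type} [NormedAddCommGroup X] [NormedSpace ℝ X]
    [FiniteDimensional ℝ X] [NormedAddCommGroup Y] [NormedSpace ℝ Y] (Ψ : X →ₗ[ℝ] Y) {c K : ℝ}
    (hc : 0 ≤ c) (hK : 0 ≤ K) (h1 : ∀ x, ‖x‖ ≤ c * ‖Ψ x‖) (h2 : ∀ x, ‖Ψ x‖ ≤ K * ‖x‖) :
    banachMazurDist X (LinearMap.range Ψ) ≤ ENNReal.ofReal (K * c) := by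
  set T : X ≃L[ℝ] LinearMap.range Ψ :=
    (LinearEquiv.ofInjective Ψ (injective_of_norm_le h1)).toContinuousLinearEquiv
  refine (iInf_le _ T).trans (ENNReal.ofReal_le_ofReal ?_)
  refine mul_le_mul (ContinuousLinearMap.opNorm_le_bound _ hK fun x => h2 x)
    (ContinuousLinearMap.opNorm_le_bound _ hc fun y => ?_) (norm_nonneg _) hK
  have h := h1 (T.symm y)
  have e : (T (T.symm y) : Y) = Ψ (T.symm y) := rfl
  rw [← e, T.apply_symm_apply] at h
  exact h

/-- Renaming the coordinates of `L_1^N`. -/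
def AvgL1.reindex {ι κ : Type} [Fintype ι] [Fintype κ] (e : ι ≃ κ) : AvgL1 ι →ₗ[ℝ] AvgL1 κ where
  toFun z := fun k => z (e.symm k)
  map_add' _ _ := rfl
  map_smul' _ _ := rfl

theorem AvgL1.norm_reindex {ι κ : Type} [Fintype ι] [Fintype κ] (e : ι ≃ κ) (z : AvgL1 ι) :
    ‖AvgL1.reindex e z‖ = ‖z‖ := by
  rw [AvgL1.norm_def, AvgL1.norm_def, Fintype.card_congr e]
  congr 1
  exact Equiv.sum_comp e.symm fun i => |z i|

/-- The step function on `[0, 1]` with the values `z k` on the intervals `(k/N, (k+1)/N]`. -/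
def stepFunction {N : ℕ} (z : Fin N → ℝ) (t : ℝ) : ℝ :=
  ∑ k : Fin N, (Ioc ((k : ℝ) / N) (((k : ℝ) + 1) / N)).indicator (fun _ => z k) t

theorem stepFunction_add {N : ℕ} (z w : Fin N → ℝ) (t : ℝ) :
    stepFunction (z + w) t = stepFunction z t + stepFunction w t := by
  rw [stepFunction, stepFunction, stepFunction, ← Finset.sum_add_distrib]
  exact Finset.sum_congr rfl fun k _ =>
    congrFun (indicator_add _ (fun _ => z k) fun _ => w k) t

theorem stepFunction_smul {N : ℕ} (c : ℝ) (z : Fin N → ℝ) (t : ℝ) :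
    stepFunction (c • z) t = c * stepFunction z t := by
  rw [stepFunction, stepFunction, Finset.mul_sum]
  exact Finset.sum_congr rfl fun k _ => indicator_const_smul_apply _ c (fun _ => z k) t

theorem integrable_indicator_Ioc_restrict (a b c : ℝ) :
    Integrable ((Ioc a b).indicator fun _ => c) (volume.restrict (Icc (0 : ℝ) 1)) :=
  (integrable_const c).indicator measurableSet_Ioc

theorem integrable_stepFunction {N : ℕ} (z : Fin N → ℝ) :
    Integrable (stepFunction z) (volume.restrict (Icc (0 : ℝ) 1)) :=
  integrable_finsetSum _ fun _ _ => integrable_indicator_Ioc_restrict _ _ _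

/-- The half-open intervals are disjoint, so at most one summand is nonzero at `t`. -/
theorem abs_stepFunction {N : ℕ} (z : Fin N → ℝ) (t : ℝ) :
    |stepFunction z t| = stepFunction (fun k => |z k|) t := by
  have huniq : ∀ k l : Fin N, t ∈ Ioc ((k : ℝ) / N) (((k : ℝ) + 1) / N) →
      t ∈ Ioc ((l : ℝ) / N) (((l : ℝ) + 1) / N) → k ≤ l := fun k l hk hl => by
    have hN : (0 : ℝ) < N := by exact_mod_cast k.pos
    have h := hk.1.trans_le hl.2
    rw [div_lt_div_iff_of_pos_right hN] at h
    exact Fin.le_def.2 (Nat.lt_succ_iff.1 (by exact_mod_cast h))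
  by_cases h : ∃ k : Fin N, t ∈ Ioc ((k : ℝ) / N) (((k : ℝ) + 1) / N)
  · obtain ⟨k, hk⟩ := h
    have hval : ∀ w : Fin N → ℝ, stepFunction w t = w k := fun w => by
      rw [stepFunction, Finset.sum_eq_single k, indicator_of_mem hk]
      · exact fun l _ hlk => indicator_of_notMem
          (fun hl => hlk (le_antisymm (huniq l k hl hk) (huniq k l hk hl))) _
      · exact fun h => absurd (Finset.mem_univ k) h
    rw [hval, hval]
  · have hval : ∀ w : Fin N → ℝ, stepFunction w t = 0 := fun w =>
      Finset.sum_eq_zero fun l _ => indicator_of_notMem (fun hl => h ⟨l, hl⟩) _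
    rw [hval, hval, abs_zero]

/-- The canonical embedding of `L_1^N` into `L_1[0, 1]`. -/
def stepMap (N : ℕ) : AvgL1 (Fin N) →ₗ[ℝ] Lp ℝ 1 (volume.restrict (Icc (0 : ℝ) 1)) where
  toFun z := (integrable_stepFunction z).toL1 (stepFunction z)
  map_add' z w := by
    rw [← Integrable.toL1_add]
    refine (Integrable.toL1_eq_toL1_iff _ _ _ _).2 (Eventually.of_forall fun t => ?_)
    exact stepFunction_add z w t
  map_smul' c z := by
    rw [RingHom.id_apply, ← Integrable.toL1_smul]
    refine (Integrable.toL1_eq_toL1_iff _ _ _ _).2 (Eventually.of_forall fun t => ?_)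
    exact stepFunction_smul c z t

theorem integral_abs_stepFunction {N : ℕ} (z : Fin N → ℝ) :
    ∫ t in Icc (0 : ℝ) 1, |stepFunction z t| = 1 / N * ∑ k, |z k| := by
  simp only [abs_stepFunction]
  simp only [stepFunction]
  rw [integral_finsetSum _ fun _ _ => integrable_indicator_Ioc_restrict _ _ _, Finset.mul_sum]
  refine Finset.sum_congr rfl fun k _ => ?_
  have hN : (0 : ℝ) < N := by exact_mod_cast k.pos
  have hsub : Ioc ((k : ℝ) / N) (((k : ℝ) + 1) / N) ⊆ Icc 0 1 := fun t ht =>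
    ⟨(div_nonneg (Nat.cast_nonneg _) hN.le).trans ht.1.le, ht.2.trans (by
      rw [div_le_one hN]
      exact_mod_cast k.2)⟩
  rw [integral_indicator_const _ measurableSet_Ioc, smul_eq_mul, measureReal_def,
    Measure.restrict_apply measurableSet_Ioc, inter_eq_self_of_subset_left hsub,
    Real.volume_Ioc, ENNReal.toReal_ofReal]
  · congr 1
    ring
  · rw [← sub_div, add_sub_cancel_left]
    positivity

theorem norm_stepMap (N : ℕ) (z : AvgL1 (Fin N)) : ‖stepMap N z‖ = ‖z‖ := by
  rw [AvgL1.norm_def, Fintype.card_fin]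
  exact (L1.norm_of_fun_eq_integral_norm (integrable_stepFunction z)).trans
    (integral_abs_stepFunction z)

end Spaces

/-! ### Distortion of the embeddings -/

theorem norm_signPermMap_bounds {n : ℕ} {M : Fin n → OrliczFunction} {α : Fin n → ℕ → ℝ}
    (hα : ∀ i, (M i).Represents n (α i)) :
    (∀ x, ‖x‖ ≤ 24 * ‖signPermMap M (fun i j => α i j) x‖) ∧
      ∀ x, ‖signPermMap M (fun i j => α i j) x‖ ≤ 10 * ‖x‖ :=
  ⟨fun x => (luxNorm_le_signPermMean hα x).trans_eq (by rw [norm_signPermMap]),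
    fun x => (norm_signPermMap M _ x).trans_le (signPermMean_le_luxNorm hα x)⟩

theorem finrank_range_and_banachMazurDist_le {n : ℕ} {M : Fin n → OrliczFunction} {Y : Type}
    [NormedAddCommGroup Y] [NormedSpace ℝ Y] {Ψ : MusielakOrliczSpace M →ₗ[ℝ] Y}
    (h1 : ∀ x, ‖x‖ ≤ 24 * ‖Ψ x‖) (h2 : ∀ x, ‖Ψ x‖ ≤ 10 * ‖x‖) :
    Module.finrank ℝ (LinearMap.range Ψ) = n ∧
      banachMazurDist (MusielakOrliczSpace M) (LinearMap.range Ψ) ≤ ENNReal.ofReal 240 := by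
  constructor
  · rw [LinearMap.finrank_range_of_inj (injective_of_norm_le h1), finrank_musielakOrliczSpace]
  · have := banachMazurDist_range_le Ψ (by norm_num) (by norm_num) h1 h2
    norm_num at this ⊢
    exact this

theorem exists_reindex {ι κ X : Type} [Fintype ι] [Fintype κ] [AddCommGroup X] [Module ℝ X]
    (e : ι ≃ κ) (Φ : X →ₗ[ℝ] AvgL1 ι) : ∃ Ψ : X →ₗ[ℝ] AvgL1 κ, ∀ x, ‖Ψ x‖ = ‖Φ x‖ :=
  ⟨AvgL1.reindex e ∘ₗ Φ, fun x => AvgL1.norm_reindex e (Φ x)⟩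

end

theorem mainTheorem3 :
    ∃ C : ℝ, 1 < C ∧ ∀ (n : ℕ) (M : Fin n → OrliczFunction),
      -- 2-concave Musielak-Orlicz spaces embed uniformly into `L_1^{2^n n!}` and `L_1[0,1]`
      ((∀ i, (M i).IsTwoConcave) →
        (∃ Y : Submodule ℝ (AvgL1 (Fin (2 ^ n * n.factorial))),
          Module.finrank ℝ Y = n ∧
          banachMazurDist (MusielakOrliczSpace M) Y ≤ ENNReal.ofReal C) ∧
        (∃ T : MusielakOrliczSpace M →ₗ[ℝ] Lp ℝ 1 (volume.restrict (Icc (0 : ℝ) 1)),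
          ∀ x, ‖x‖ ≤ ‖T x‖ ∧ ‖T x‖ ≤ C * ‖x‖)) ∧
      -- the explicit embedding
      ((∀ i, StrictConvexOn ℝ (Ici 0) (M i) ∧ (M i).IsTwiceDifferentiable ∧
          (∀ t : ℝ, 0 < t → 0 < deriv (deriv (M i)) t) ∧
          Tendsto (fun t : ℝ => M i t / t) (𝓝[>] 0) (𝓝 0) ∧
          (M i).IsStrictlyTwoConcave) →
        (∀ x, C⁻¹ * ‖x‖ ≤ ‖embedding M x‖ ∧ ‖embedding M x‖ ≤ C * ‖x‖) ∧
        Module.finrank ℝ (LinearMap.range (embedding M)) = n ∧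
        banachMazurDist (MusielakOrliczSpace M) (LinearMap.range (embedding M)) ≤
          ENNReal.ofReal C) := by
  -- `240 = 24 · 10`, the product of the two norm bounds; scaling by 24 below turns the lower bound
  -- for `T` into 1.
  refine ⟨240, by norm_num, fun n M => ⟨fun hM => ?_, fun hM => ?_⟩⟩
  · choose α hα using fun i : Fin n => OrliczFunction.exists_represents (hM i) i.pos
    obtain ⟨h1, h2⟩ := norm_signPermMap_bounds hα
    obtain ⟨Ψ, hn⟩ := exists_reindex (Fintype.equivFinOfCardEq (card_signPerm n))
      (signPermMap M fun i j => α i j)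
    simp only [← hn] at h1 h2
    refine ⟨⟨LinearMap.range Ψ, finrank_range_and_banachMazurDist_le h1 h2⟩,
      (24 : ℝ) • (stepMap _ ∘ₗ Ψ), fun x => ?_⟩
    have hT : ‖((24 : ℝ) • (stepMap _ ∘ₗ Ψ)) x‖ = 24 * ‖Ψ x‖ := by
      rw [LinearMap.smul_apply, LinearMap.comp_apply, norm_smul, norm_stepMap,
        Real.norm_of_nonneg (by norm_num)]
    rw [hT]
    exact ⟨h1 x, by linarith [h2 x]⟩
  · have hreg : ∀ i, (M i).IsRegular := fun i =>
      ⟨(hM i).2.1, (hM i).2.2.1, (hM i).2.2.2.1, (hM i).2.2.2.2⟩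
    obtain ⟨h1, h2⟩ := norm_signPermMap_bounds fun i => (hreg i).represents i.pos
    have e : embedding M = signPermMap M fun i j => n * ∫ t in ((j : ℕ) : ℝ) / n..
        (((j : ℕ) : ℝ) + 1) / n, (M i).density t := embedding_eq_signPermMap M
    rw [← e] at h1 h2
    refine ⟨fun x => ⟨?_, ?_⟩, finrank_range_and_banachMazurDist_le h1 h2⟩
    · linarith [h1 x, norm_nonneg (embedding M x)]
    · linarith [h2 x, norm_nonneg x]
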